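/- **Setting.** Let $L=L_{\mathcal R}\cup L_{\mathcal F}$ be a (possibly infinite) language consisting of relation symbols $R\in L_{\mathcal R}$, each of a finite arity $a(R)\ge 1$, and unary function symbols $F\in L_{\mathcal F}$. Let $\Gamma_L$ be a group of permutations of $L$ which map relation symbols to relation symbols of the same arity and function symbols to function symbols. A *$\Gamma_L$-structure* $\mathbf A$ is a (possibly empty) vertex set $A$ with relations $R_{\mathbf A}\subseteq A^{a(R)}$ for $R\in L_{\mathcal R}$ and functions $F_{\mathbf A}\colon A\to\mathcal P(A)$ for $F\in L_{\mathcal F}$; it is finite if $A$ is finite. *Maps.* An *embedding* $f\colon\mathbf A\to\mathbf B$ is a pair $(f_L,f_A)$ with $f_L\in\Gamma_L$ and $f_A\colon A\to B$ injective such that $\bar x\in R_{\mathbf A}\iff f_A(\bar x)\in f_L(R)_{\mathbf B}$ and $f_A(F_{\mathbf A}(x))=f_L(F)_{\mathbf B}(f_A(x))$ for all $R$, $F$, $\bar x$, $x$. Embeddings are composed in both coordinates. An *isomorphism* is an embedding with $f_A$ bijective; an *automorphism* is an isomorphism from a structure to itself. $\mathbf A$ is a *substructure* of $\mathbf B$ if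 $A\subseteq B$ and $(\mathrm{id}_L,\text{inclusion})$ is an embedding; substructures of $\mathbf B$ correspond to the subsets of $B$ closed under all functions of $\mathbf B$. For an embedding $\psi\colon \mathbf A\to\mathbf B$, $\psi(\mathbf A)$ is the substructure of $\mathbf B$ with vertex set $\psi(A)$. *Relabelling.* $g\in\Gamma_L$ acts on the $\Gamma_L$-structures with vertex set $A$ by $R_{g\mathbf A}=(g^{-1}R)_{\mathbf A}$ and $F_{g\mathbf A}=(g^{-1}F)_{\mathbf A}$. *Amalgamation.* Let $\alpha_i\colon\mathbf A\to\mathbf B_i$ ($i=1,2$) be embeddings. A structure $\mathbf C$ with embeddings $\beta_i\colon\mathbf B_i\to\mathbf C$ is an *amalgamation* of $\mathbf B_1,\mathbf B_2$ over $\mathbf A$ with respect to $\alpha_1,\alpha_2$ if $\beta_1\alpha_1=\beta_2\alpha_2$ (also for the language parts). It is *free* if moreover $\beta_1(x_1)=\beta_2(x_2)$ holds if and only if $x_1=\alpha_1(a)$ and $x_2=\alpha_2(a)$ for some $a\in A$; $C=\beta_1(B_1)\cup\beta_2(B_2)$; and no tuple in a relation of $\mathbf C$ contains vertices of both $\beta_1(B_1\setminus\alpha_1(A))$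 and $\beta_2(B_2\setminus\alpha_2(A))$. A structure is *irreducible* if it is not the free amalgamation of two of its proper substructures over their intersection (with respect to the inclusions). A *free amalgamation class* is an isomorphism-closed class $\mathcal K$ of finite $\Gamma_L$-structures such that every structure which embeds into a member of $\mathcal K$ is in $\mathcal K$; any two members of $\mathcal K$ embed into a common member of $\mathcal K$; and for all $\mathbf A,\mathbf B_1,\mathbf B_2\in\mathcal K$ and embeddings $\alpha_i\colon\mathbf A\to\mathbf B_i$ some $\mathbf C\in\mathcal K$ is, with suitable $\beta_1,\beta_2$, a free amalgamation of $\mathbf B_1,\mathbf B_2$ over $\mathbf A$ with respect to $\alpha_1,\alpha_2$. *EPPA.* A *partial automorphism* of a structure is an isomorphism between two of its substructures; it *extends* to an automorphism $\theta$ if $\theta$ has the same language part and agrees with it on its domain. An embedding $\psi\colon\mathbf A\to\mathbf B$ is an *EPPA-witness* if every partial automorphism of $\psi(\mathbf A)$ extends to an automorphism of $\mathbf B$. It is *coherent* if one can choose for each partial automorphism $f$ of $\psi(\mathbf A)$ an automorphism $\hat f$ of $\mathbf B$ extending $f$ so that $\hat h=\hat g\circ\hat f$ whenever $\mathrm{Dom}(f)=\mathrm{Dom}(h)$,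 $\mathrm{Range}(f)=\mathrm{Dom}(g)$, $\mathrm{Range}(g)=\mathrm{Range}(h)$ and $h=g\circ f$. It is *irreducible structure faithful* if for every irreducible substructure $\mathbf D$ of $\mathbf B$ there is an automorphism $g$ of $\mathbf B$ with $g(D)\subseteq\psi(A)$. A class $\mathcal K$ of finite $\Gamma_L$-structures has *EPPA* (respectively *irreducible structure faithful coherent EPPA*) if for every $\mathbf A\in\mathcal K$ there are $\mathbf B\in\mathcal K$ and an embedding $\psi\colon\mathbf A\to\mathbf B$ which is an EPPA-witness (respectively an irreducible structure faithful coherent EPPA-witness). **Statement.** Let $\mathcal K$ be a free amalgamation class of finite $\Gamma_L$-structures. Then $\mathcal K$ has EPPA if and only if every $\mathbf A\in\mathcal K$ lies in a finite orbit of the action of $\Gamma_L$ on $\Gamma_L$-structures by relabelling. Moreover, if $\mathcal K$ has EPPA, then it has irreducible structure faithful coherent EPPA. -/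

import Mathlib

universe u v w

namespace GammaL

/-- A language consisting of relation symbols (`Rel n` is the set of relation symbols of
arity `n`, arities being at least `1`) and of unary function symbols. -/
structure UnaryLanguage where
  Rel : ℕ → Type u
  rel_zero : IsEmpty (Rel 0)
  Fn : Type v

/-- The group of all permutations of the language which preserve types and arities of symbols.
A language equipped with a permutation group is a language `L` with a subgroup of `L.Perm`. -/
abbrev UnaryLanguage.Perm (L : UnaryLanguage.{u, v}) : Type (max u v) :=
  (∀ n, Equiv.Perm (L.Rel n)) × Equiv.Perm L.Fn

/-- An interpretation of the symbols of `L` on a vertex set `V`. The value of a function symbol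
at a vertex is a set of vertices. -/
@[ext]
structure Interp (L : UnaryLanguage.{u, v}) (V : Type w) where
  rel : ∀ n, L.Rel n → Set (Fin n → V)
  fn : L.Fn → V → Set V

/-- The action by relabelling: `g • S` interprets a symbol `s` as `S` interprets `g⁻¹ s`. -/
instance (L : UnaryLanguage.{u, v}) (V : Type w) : MulAction L.Perm (Interp L V) where
  smul g S :=
    { rel := fun n r => S.rel n ((g⁻¹).1 n r)
      fn := fun F => S.fn ((g⁻¹).2 F) }
  one_smul _ := rfl
  mul_smul g h S := by
    have e : (g * h)⁻¹ = h⁻¹ * g⁻¹ := mul_inv_rev g h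
    change Interp.mk _ _ = Interp.mk _ _
    rw [e]
    rfl

/-- A structure: a vertex set with an interpretation of the symbols of `L`. -/
structure Struc (L : UnaryLanguage.{u, v}) where
  V : Type w
  str : Interp L V

section Maps

variable {L : UnaryLanguage.{u, v}}

/-- An embedding: a permutation of the language from `Γ` together with an injective map of the
vertices, which preserve and reflect relations and commute with functions. -/
structure Embedding (Γ : Subgroup L.Perm) (A B : Struc.{u, v, w} L) where
  lang : Γ
  toFun : A.V → B.V
  injective : Function.Injective toFun
  map_rel : ∀ n (r : L.Rel n) (x : Fin n → A.V),
    x ∈ A.str.rel n r ↔ toFun ∘ x ∈ B.str.rel n (lang.1.1 n r)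
  map_fn : ∀ (F : L.Fn) (x : A.V), toFun '' A.str.fn F x = B.str.fn (lang.1.2 F) (toFun x)

/-- Composition of embeddings (`f` first), on the language and on the vertices. -/
def Embedding.comp {Γ : Subgroup L.Perm} {A B C : Struc.{u, v, w} L}
    (g : Embedding Γ B C) (f : Embedding Γ A B) : Embedding Γ A C where
  lang := g.lang * f.lang
  toFun := g.toFun ∘ f.toFun
  injective := g.injective.comp f.injective
  map_rel n r x := (f.map_rel n r x).trans (g.map_rel n _ _)
  map_fn F x := by
    rw [Set.image_comp, f.map_fn, g.map_fn]
    rfl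

/-- An isomorphism: an embedding which is bijective on vertices. -/
structure Iso (Γ : Subgroup L.Perm) (A B : Struc.{u, v, w} L) extends Embedding Γ A B where
  surjective : Function.Surjective toFun

/-- Substructures of `A` correspond to sets of vertices closed under all functions. -/
structure Substruc (A : Struc.{u, v, w} L) where
  verts : Set A.V
  closed : ∀ (F : L.Fn), ∀ x ∈ verts, A.str.fn F x ⊆ verts

/-- The structure which a closed set of vertices carries. -/
def Substruc.toStruc {A : Struc.{u, v, w} L} (S : Substruc A) : Struc.{u, v, w} L where
  V := S.verts
  str :=
    { rel := fun n r => {x | (fun i => (x i : A.V)) ∈ A.str.rel n r}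
      fn := fun F x => {y | (y : A.V) ∈ A.str.fn F x} }

/-- The inclusion between two substructures, with the identity on the language. -/
def Substruc.inclusion (Γ : Subgroup L.Perm) {A : Struc.{u, v, w} L} {S T : Substruc A}
    (h : S.verts ⊆ T.verts) : Embedding Γ S.toStruc T.toStruc where
  lang := 1
  toFun := Set.inclusion h
  injective := Set.inclusion_injective h
  map_rel _ _ _ := Iff.rfl
  map_fn F x := by
    ext y
    constructor
    · rintro ⟨z, hz, rfl⟩
      exact hz
    · intro hy
      exact ⟨⟨y.1, S.closed F x.1 x.2 hy⟩, hy, rfl⟩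

/-- The inclusion of a substructure, with the identity on the language. -/
def Substruc.subtype (Γ : Subgroup L.Perm) {A : Struc.{u, v, w} L} (S : Substruc A) :
    Embedding Γ S.toStruc A where
  lang := 1
  toFun := Subtype.val
  injective := Subtype.val_injective
  map_rel _ _ _ := Iff.rfl
  map_fn F x := by
    ext y
    constructor
    · rintro ⟨z, hz, rfl⟩
      exact hz
    · intro hy
      exact ⟨⟨y, S.closed F x.1 x.2 hy⟩, hy, rfl⟩

/-- The intersection of two substructures. -/
def Substruc.inter {A : Struc.{u, v, w} L} (S T : Substruc A) : Substruc A where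
  verts := S.verts ∩ T.verts
  closed F x hx := Set.subset_inter (S.closed F x hx.1) (T.closed F x hx.2)

/-- The image `ψ(A)` of an embedding `ψ : A → B`, a substructure of `B`. -/
def Embedding.range {Γ : Subgroup L.Perm} {A B : Struc.{u, v, w} L} (ψ : Embedding Γ A B) :
    Substruc B where
  verts := Set.range ψ.toFun
  closed := by
    rintro F _ ⟨x, rfl⟩
    have h := ψ.map_fn (ψ.lang.1.2.symm F) x
    rw [Equiv.apply_symm_apply] at h
    rw [← h]
    exact Set.image_subset_range _ _

/-! ### Amalgamation -/

/-- `C` with `β₁`, `β₂` is an amalgamation of `B₁` and `B₂` over `A` with respect to `α₁`, `α₂`;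
the equality of the compositions includes their language parts. -/
def IsAmalgamation {Γ : Subgroup L.Perm} {A B₁ B₂ C : Struc.{u, v, w} L}
    (α₁ : Embedding Γ A B₁) (α₂ : Embedding Γ A B₂)
    (β₁ : Embedding Γ B₁ C) (β₂ : Embedding Γ B₂ C) : Prop :=
  β₁.comp α₁ = β₂.comp α₂

/-- The amalgamation is strong: the images of `B₁` and `B₂` meet only in the image of `A`. -/
def IsStrongAmalgamation {Γ : Subgroup L.Perm} {A B₁ B₂ C : Struc.{u, v, w} L}
    (α₁ : Embedding Γ A B₁) (α₂ : Embedding Γ A B₂)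
    (β₁ : Embedding Γ B₁ C) (β₂ : Embedding Γ B₂ C) : Prop :=
  IsAmalgamation α₁ α₂ β₁ β₂ ∧
    ∀ x₁ x₂, β₁.toFun x₁ = β₂.toFun x₂ ↔ ∃ a, α₁.toFun a = x₁ ∧ α₂.toFun a = x₂

/-- The amalgamation is free: it is strong, `C` is the union of the images of `B₁` and `B₂`, and
no tuple in a relation of `C` has vertices both in `β₁(B₁ \ α₁(A))` and in `β₂(B₂ \ α₂(A))`.
(There is no condition on functions: these are unary, and a single vertex does not lie in both
of these disjoint sets.) -/
def IsFreeAmalgamation {Γ : Subgroup L.Perm} {A B₁ B₂ C : Struc.{u, v, w} L}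
    (α₁ : Embedding Γ A B₁) (α₂ : Embedding Γ A B₂)
    (β₁ : Embedding Γ B₁ C) (β₂ : Embedding Γ B₂ C) : Prop :=
  IsStrongAmalgamation α₁ α₂ β₁ β₂ ∧
    Set.range β₁.toFun ∪ Set.range β₂.toFun = Set.univ ∧
    ∀ n (r : L.Rel n) (x : Fin n → C.V),
      (∃ i, x i ∈ β₁.toFun '' (Set.range α₁.toFun)ᶜ) →
      (∃ j, x j ∈ β₂.toFun '' (Set.range α₂.toFun)ᶜ) →
      x ∉ C.str.rel n r

/-- A structure is irreducible if it is not the free amalgamation of two proper substructures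
(over their intersection, with respect to the inclusions). -/
def Irreducible (Γ : Subgroup L.Perm) (C : Struc.{u, v, w} L) : Prop :=
  ¬ ∃ S T : Substruc C, S.verts ≠ Set.univ ∧ T.verts ≠ Set.univ ∧
    IsFreeAmalgamation
      (Substruc.inclusion Γ (S := S.inter T) (T := S) Set.inter_subset_left)
      (Substruc.inclusion Γ (S := S.inter T) (T := T) Set.inter_subset_right)
      (S.subtype Γ) (T.subtype Γ)

/-- An amalgamation class of finite structures. -/
structure IsAmalgamationClass (Γ : Subgroup L.Perm) (K : Set (Struc.{u, v, w} L)) : Prop where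
  finite : ∀ A ∈ K, Finite A.V
  closed_iso : ∀ A ∈ K, ∀ B, Nonempty (Iso Γ A B) → B ∈ K
  hereditary : ∀ A ∈ K, ∀ B, Nonempty (Embedding Γ B A) → B ∈ K
  joint_embedding : ∀ A ∈ K, ∀ B ∈ K,
    ∃ C ∈ K, Nonempty (Embedding Γ A C) ∧ Nonempty (Embedding Γ B C)
  amalgamation : ∀ A ∈ K, ∀ B₁ ∈ K, ∀ B₂ ∈ K,
    ∀ (α₁ : Embedding Γ A B₁) (α₂ : Embedding Γ A B₂),
      ∃ C ∈ K, ∃ (β₁ : Embedding Γ B₁ C) (β₂ : Embedding Γ B₂ C), IsAmalgamation α₁ α₂ β₁ β₂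

/-- A free amalgamation class: the amalgamation can always be chosen to be free. -/
structure IsFreeAmalgamationClass (Γ : Subgroup L.Perm) (K : Set (Struc.{u, v, w} L)) : Prop
    extends IsAmalgamationClass Γ K where
  free_amalgamation : ∀ A ∈ K, ∀ B₁ ∈ K, ∀ B₂ ∈ K,
    ∀ (α₁ : Embedding Γ A B₁) (α₂ : Embedding Γ A B₂),
      ∃ C ∈ K, ∃ (β₁ : Embedding Γ B₁ C) (β₂ : Embedding Γ B₂ C), IsFreeAmalgamation α₁ α₂ β₁ β₂

/-! ### EPPA -/

/-- A partial automorphism of `B`: an isomorphism (including a permutation of the language from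
`Γ`) between two substructures of `B`. -/
structure PartialAut (Γ : Subgroup L.Perm) (B : Struc.{u, v, w} L) where
  dom : Substruc B
  cod : Substruc B
  iso : Iso Γ dom.toStruc cod.toStruc

/-- The value of a partial automorphism at a vertex of its domain, as a vertex of `B`. -/
def PartialAut.app {Γ : Subgroup L.Perm} {B : Struc.{u, v, w} L} (p : PartialAut Γ B)
    (x : p.dom.verts) : B.V :=
  (p.cod.subtype Γ).toFun (p.iso.toFun x)

/-- `p` is a partial automorphism of the substructure `S` of `B`. -/
def PartialAut.IsOn {Γ : Subgroup L.Perm} {B : Struc.{u, v, w} L} (p : PartialAut Γ B)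
    (S : Substruc B) : Prop :=
  p.dom.verts ⊆ S.verts ∧ p.cod.verts ⊆ S.verts

/-- The automorphism `θ` of `B` extends `p`, with the same permutation of the language. -/
def PartialAut.ExtendsTo {Γ : Subgroup L.Perm} {B : Struc.{u, v, w} L} (p : PartialAut Γ B)
    (θ : Iso Γ B B) : Prop :=
  θ.lang = p.iso.lang ∧ ∀ x : p.dom.verts, θ.toFun x = p.app x

/-- `(f, g, h)` is a coherent triple: `Dom f = Dom h`, `Range f = Dom g`, `Range g = Range h` and
`h = g ∘ f` (on the language and on the vertices). -/
def CoherentTriple {Γ : Subgroup L.Perm} {B : Struc.{u, v, w} L} (f g h : PartialAut Γ B) : Prop :=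
  f.dom.verts = h.dom.verts ∧ f.cod.verts = g.dom.verts ∧ g.cod.verts = h.cod.verts ∧
    h.iso.lang = g.iso.lang * f.iso.lang ∧
    ∀ (x : f.dom.verts) (y : g.dom.verts) (z : h.dom.verts),
      (z : B.V) = x → (y : B.V) = f.app x → h.app z = g.app y

/-- The embedding `ψ : A → B` makes `B` an EPPA-witness for `A`. -/
def IsEPPAEmbedding {Γ : Subgroup L.Perm} {A B : Struc.{u, v, w} L} (ψ : Embedding Γ A B) : Prop :=
  ∀ p : PartialAut Γ B, p.IsOn ψ.range → ∃ θ : Iso Γ B B, p.ExtendsTo θ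

/-- The embedding `ψ : A → B` makes `B` a coherent EPPA-witness for `A`: all partial automorphisms
of `ψ(A)` extend to automorphisms of `B` in such a way that coherent triples are mapped to
coherent triples. As automorphisms are defined everywhere, coherence of their triples
just says that the third is the composition of the first two. -/
def IsCoherentEPPAEmbedding {Γ : Subgroup L.Perm} {A B : Struc.{u, v, w} L}
    (ψ : Embedding Γ A B) : Prop :=
  ∃ φ : {p : PartialAut Γ B // p.IsOn ψ.range} → Iso Γ B B,
    (∀ p : {p : PartialAut Γ B // p.IsOn ψ.range}, p.1.ExtendsTo (φ p)) ∧
    ∀ f g h : {p : PartialAut Γ B // p.IsOn ψ.range}, CoherentTriple f.1 g.1 h.1 →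
      (φ h).toEmbedding = (φ g).toEmbedding.comp (φ f).toEmbedding

/-- `B` is irreducible structure faithful with respect to `ψ(A)`: every irreducible substructure
of `B` is sent into `ψ(A)` by an automorphism of `B`. -/
def IsIrreducibleStructureFaithful {Γ : Subgroup L.Perm} {A B : Struc.{u, v, w} L}
    (ψ : Embedding Γ A B) : Prop :=
  ∀ C : Substruc B, Irreducible Γ C.toStruc →
    ∃ g : Iso Γ B B, g.toFun '' C.verts ⊆ ψ.range.verts

/-- The extension property for partial automorphisms (EPPA) of a class. -/
def HasEPPA (Γ : Subgroup L.Perm) (K : Set (Struc.{u, v, w} L)) : Prop :=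
  ∀ A ∈ K, ∃ B ∈ K, ∃ ψ : Embedding Γ A B, IsEPPAEmbedding ψ

/-- Irreducible structure faithful coherent EPPA of a class. -/
def HasFaithfulCoherentEPPA (Γ : Subgroup L.Perm) (K : Set (Struc.{u, v, w} L)) : Prop :=
  ∀ A ∈ K, ∃ B ∈ K, ∃ ψ : Embedding Γ A B,
    IsCoherentEPPAEmbedding ψ ∧ IsIrreducibleStructureFaithful ψ

end Maps

end GammaL

/-!
Partial automorphisms with empty domain have arbitrary language parts. If they all extend to
automorphisms of a finite `B`, then every relabelling of `A` embeds into `B` with one and the same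
language part, hence is determined by a map from the vertices of `A` to those of `B`, and there are
only finitely many of these.

Conversely, let `A` have a finite orbit. We look for a finite set `V` containing the vertices of
`A` and a group `H` of permutations of `V`, labelled by elements of `Γ`, which coherently extends
all partial automorphisms of `A` and in which every element induces a partial automorphism on the
vertices that it keeps in `A`. The translates of `A` under `H` then form a finite structure `B`.

* A partial bijection extends coherently to a permutation by matching the complements of its domain
  and its range in the order of fixed enumerations.
* To have partial automorphisms induced, a vertex of `V` is a vertex of `A` with a value in `𝔽_p` at
  each pair of a set `s` of vertices and an interpretation in the finite orbit of `A`. Elements of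
  `H` add constants with sum zero over `s`. The value of `A` at such a pair tells whether the
  interpretation agrees with `A` on `s`; if all of `s` stays in `A`, then these constants are all
  equal, hence zero as `p` exceeds `|s|`, and the element of `H` respects agreement on `s`.
* To make `B` faithful, each vertex is moreover given a colour at each set `M` which contains it and
  cannot be moved into `A`. The vertices of `A` have distinct colours at `M`, but there are fewer
  than `|M|` colours, so that a set in which any two vertices can be moved into `A` can be moved
  into `A` as a whole.

An irreducible structure which is covered by substructures, each relation lying in one of them, has
any two of its vertices in a common one of them. So irreducible substructures of `B` can be moved
into `A` and lie in `K`. Since reducible structures are free amalgamations of smaller ones, `B` lies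
in `K` as well.
-/

namespace GammaL

open Equiv (Perm)
open scoped SetRel Pointwise

/-! ### Coherent extension of partial bijections -/

section PartialBijections

variable {N N' N'' : Type*}

/-- A relation which is the graph of a partial bijection. -/
def IsPartialBij (R : SetRel N N') : Prop :=
  ∀ ⦃x y x' y'⦄, (x, y) ∈ R → (x', y') ∈ R → (x = x' ↔ y = y')

theorem IsPartialBij.comp {R : SetRel N N'} {S : SetRel N' N''} (hR : IsPartialBij R)
    (hS : IsPartialBij S) : IsPartialBij (R ○ S) := by
  rintro x z x' z' ⟨y, hxy, hyz⟩ ⟨y', hxy', hyz'⟩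
  exact (hR hxy hxy').trans (hS hyz hyz')

theorem IsPartialBij.ncard_dom_eq_ncard_cod {R : SetRel N N'} (hR : IsPartialBij R) :
    R.dom.ncard = R.cod.ncard := by
  have dom_eq : R.dom = Prod.fst '' R := by ext; simp [SetRel.dom]
  have cod_eq : R.cod = Prod.snd '' R := by ext; simp [SetRel.cod]
  rw [dom_eq, cod_eq,
    Set.InjOn.ncard_image fun p hp q hq h => Prod.ext h ((hR hp hq).1 h),
    Set.InjOn.ncard_image fun p hp q hq h => Prod.ext ((hR hp hq).2 h) h]

theorem dom_comp_of_cod_eq_dom {R : SetRel N N'} {S : SetRel N' N''} (h : R.cod = S.dom) :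
    (R ○ S).dom = R.dom := by
  ext x
  constructor
  · rintro ⟨z, y, hxy, -⟩
    exact ⟨y, hxy⟩
  · rintro ⟨y, hxy⟩
    obtain ⟨z, hyz⟩ : y ∈ S.dom := h ▸ ⟨x, hxy⟩
    exact ⟨z, y, hxy, hyz⟩

theorem cod_comp_of_cod_eq_dom {R : SetRel N N'} {S : SetRel N' N''} (h : R.cod = S.dom) :
    (R ○ S).cod = S.cod := by
  ext z
  constructor
  · rintro ⟨x, y, -, hyz⟩
    exact ⟨y, hyz⟩
  · rintro ⟨y, hyz⟩
    obtain ⟨x, hxy⟩ : y ∈ R.cod := h ▸ ⟨z, hyz⟩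
    exact ⟨x, y, hxy, hyz⟩

theorem apply_mem_cod_iff_mem_dom {R : SetRel N N} {σ : Perm N}
    (hσ : ∀ x y, (x, y) ∈ R → σ x = y) (x : N) : σ x ∈ R.cod ↔ x ∈ R.dom := by
  constructor
  · rintro ⟨x', hx'⟩
    obtain rfl := σ.injective (hσ _ _ hx')
    exact ⟨_, hx'⟩
  · rintro ⟨y, hxy⟩
    exact ⟨x, hσ x y hxy ▸ hxy⟩

/-- The completion of `R` to a total relation which matches the vertices outside of its domain
with those outside of its codomain in the order given by the enumerations `e X : X → ℕ`. -/
def completion (e : Set N → N → ℕ) (R : SetRel N N) : SetRel N N :=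
  R ∪ {(x, y) | e R.domᶜ x = e R.codᶜ y ∧ x ∉ R.dom ∧ y ∉ R.cod}

theorem isPartialBij_completion {e : Set N → N → ℕ} (he : ∀ X, Set.InjOn (e X) X)
    {R : SetRel N N} (hR : IsPartialBij R) : IsPartialBij (completion e R) := by
  rintro x y x' y' (h | ⟨h, hx, hy⟩) (h' | ⟨h', hx', hy'⟩)
  · exact hR h h'
  · exact iff_of_false (fun e => hx' ⟨y, e ▸ h⟩) fun e => hy' ⟨x, e ▸ h⟩
  · exact iff_of_false (fun e => hx ⟨y', e ▸ h'⟩) fun e => hy ⟨x', e ▸ h'⟩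
  · rw [← (he R.domᶜ).eq_iff hx hx', ← (he R.codᶜ).eq_iff hy hy', h, h']

theorem mem_dom_completion [Finite N] {e : Set N → N → ℕ}
    (he : ∀ X, Set.BijOn (e X) X (Set.Iio X.ncard)) {R : SetRel N N} (hR : IsPartialBij R)
    (x : N) : x ∈ (completion e R).dom := by
  by_cases hx : x ∈ R.dom
  · obtain ⟨y, hxy⟩ := hx
    exact ⟨y, Or.inl hxy⟩
  · have ncard_eq : R.domᶜ.ncard = R.codᶜ.ncard := by
      rw [Set.ncard_compl, hR.ncard_dom_eq_ncard_cod, ← Set.ncard_compl]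
    obtain ⟨y, hy, hxy⟩ := (he R.codᶜ).surjOn (ncard_eq ▸ (he R.domᶜ).mapsTo hx)
    exact ⟨y, Or.inr ⟨hxy.symm, hx, hy⟩⟩

theorem completion_comp_subset (e : Set N → N → ℕ) {R S : SetRel N N} (h : R.cod = S.dom) :
    completion e R ○ completion e S ⊆ completion e (R ○ S) := by
  rintro ⟨x, z⟩ ⟨y, hxy | ⟨hxy, hx, hy⟩, hyz | ⟨hyz, hy', hz⟩⟩
  · exact Or.inl ⟨y, hxy, hyz⟩
  · exact absurd (h ▸ ⟨x, hxy⟩) hy'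
  · exact absurd (h ▸ ⟨z, hyz⟩) hy
  · refine Or.inr ⟨?_, ?_, ?_⟩
    · rw [dom_comp_of_cod_eq_dom h, cod_comp_of_cod_eq_dom h, hxy, h, hyz]
    · rwa [dom_comp_of_cod_eq_dom h]
    · rwa [cod_comp_of_cod_eq_dom h]

theorem IsPartialBij.exists_perm [Finite N] {R : SetRel N N} (hR : IsPartialBij R)
    (hdom : ∀ x, x ∈ R.dom) : ∃ σ : Perm N, ∀ x, (x, σ x) ∈ R := by
  choose f hf using hdom
  have f_inj : f.Injective := fun x x' h => (hR (hf x) (hf x')).2 h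
  exact ⟨Equiv.ofBijective f (Finite.injective_iff_bijective.1 f_inj), hf⟩

theorem exists_bijOn_Iio_ncard [Finite N] (X : Set N) :
    ∃ e : N → ℕ, Set.BijOn e X (Set.Iio X.ncard) := by
  refine X.toFinite.exists_bijOn_of_encard_eq ?_
  rw [← X.toFinite.cast_ncard_eq, ← (Set.finite_Iio _).cast_ncard_eq, Set.ncard_Iio_nat]

theorem exists_coherent_extension (N : Type*) [Finite N] :
    ∃ E : SetRel N N → Perm N,
      (∀ R, IsPartialBij R → ∀ x y, (x, y) ∈ R → E R x = y) ∧
      ∀ R S, IsPartialBij R → IsPartialBij S → R.cod = S.dom → E (R ○ S) = E S * E R := by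
  choose e he using exists_bijOn_Iio_ncard (N := N)
  have completed_bij {R : SetRel N N} (hR : IsPartialBij R) : IsPartialBij (completion e R) :=
    isPartialBij_completion (fun X => (he X).injOn) hR
  have exists_extension : ∀ R : SetRel N N, ∃ σ : Perm N,
      IsPartialBij R → ∀ x, (x, σ x) ∈ completion e R := by
    intro R
    by_cases hR : IsPartialBij R
    · obtain ⟨σ, hσ⟩ := (completed_bij hR).exists_perm (mem_dom_completion he hR)
      exact ⟨σ, fun _ => hσ⟩
    · exact ⟨1, fun h => absurd h hR⟩
  choose E hE using exists_extension
  refine ⟨E, fun R hR x y hxy => (completed_bij hR (hE R hR x) (Or.inl hxy)).1 rfl,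
    fun R S hR hS h => Equiv.ext fun x => ?_⟩
  exact (completed_bij (hR.comp hS) (hE _ (hR.comp hS) x)
    (completion_comp_subset e h ⟨_, hE R hR x, hE S hS _⟩)).1 rfl

/-- The extension of a relation on `X` by the identity outside of `X`. -/
def padOutside (X : Set N) (R : SetRel N N) : SetRel N N :=
  R ∪ {(x, y) | x = y ∧ x ∉ X}

theorem isPartialBij_padOutside {X : Set N} {R : SetRel N N} (hR : IsPartialBij R)
    (hdom : R.dom ⊆ X) (hcod : R.cod ⊆ X) : IsPartialBij (padOutside X R) := by
  rintro x y x' y' (h | ⟨rfl, hx⟩) (h' | ⟨rfl, hx'⟩)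
  · exact hR h h'
  · exact iff_of_false (fun e => hx' (e ▸ hdom ⟨_, h⟩)) fun e => hx' (e ▸ hcod ⟨_, h⟩)
  · exact iff_of_false (fun e => hx (e ▸ hdom ⟨_, h'⟩)) fun e => hx (e ▸ hcod ⟨_, h'⟩)
  · rfl

theorem padOutside_comp {X : Set N} {R S : SetRel N N} (hR : R.cod ⊆ X) (hS : S.dom ⊆ X) :
    padOutside X (R ○ S) = padOutside X R ○ padOutside X S := by
  ext ⟨x, z⟩
  constructor
  · rintro (⟨y, hxy, hyz⟩ | ⟨rfl, hx⟩)
    · exact ⟨y, Or.inl hxy, Or.inl hyz⟩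
    · exact ⟨x, Or.inr ⟨rfl, hx⟩, Or.inr ⟨rfl, hx⟩⟩
  · rintro ⟨y, hxy | ⟨rfl, hx⟩, hyz | ⟨rfl, hy⟩⟩
    · exact Or.inl ⟨y, hxy, hyz⟩
    · exact absurd (hR ⟨_, hxy⟩) hy
    · exact absurd (hS ⟨_, hyz⟩) hx
    · exact Or.inr ⟨rfl, hx⟩

theorem dom_padOutside (X : Set N) (R : SetRel N N) : (padOutside X R).dom = R.dom ∪ Xᶜ := by
  ext x
  constructor
  · rintro ⟨y, h | ⟨rfl, hx⟩⟩
    · exact Or.inl ⟨y, h⟩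
    · exact Or.inr hx
  · rintro (⟨y, h⟩ | hx)
    · exact ⟨y, Or.inl h⟩
    · exact ⟨x, Or.inr ⟨rfl, hx⟩⟩

theorem cod_padOutside (X : Set N) (R : SetRel N N) : (padOutside X R).cod = R.cod ∪ Xᶜ := by
  ext y
  constructor
  · rintro ⟨x, h | ⟨rfl, hy⟩⟩
    · exact Or.inl ⟨x, h⟩
    · exact Or.inr hy
  · rintro (⟨x, h⟩ | hy)
    · exact ⟨x, Or.inl h⟩
    · exact ⟨y, Or.inr ⟨rfl, hy⟩⟩

theorem exists_coherent_extension_on (N : Type*) [Finite N] :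
    ∃ E : Set N → SetRel N N → Perm N,
      (∀ X R, IsPartialBij R → R.dom ⊆ X → R.cod ⊆ X →
        E X R ∈ MulAction.stabilizer (Perm N) X ∧ ∀ x y, (x, y) ∈ R → E X R x = y) ∧
      ∀ X R S, IsPartialBij R → IsPartialBij S → R.dom ⊆ X → R.cod = S.dom → S.dom ⊆ X →
        S.cod ⊆ X → E X (R ○ S) = E X S * E X R := by
  obtain ⟨E, hE, hE_comp⟩ := exists_coherent_extension N
  refine ⟨fun X R => E (padOutside X R), fun X R hR hdom hcod => ?_,
    fun X R S hR hS hRX h hX hSX => ?_⟩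
  · have extends_padded := hE _ (isPartialBij_padOutside hR hdom hcod)
    refine ⟨?_, fun x y hxy => extends_padded x y (Or.inl hxy)⟩
    rw [← stabilizer_compl, MulAction.mem_stabilizer_set' Xᶜ.toFinite]
    intro x hx
    rwa [Perm.smul_def, extends_padded x x (Or.inr ⟨rfl, hx⟩)]
  · change E _ = E _ * E _
    rw [padOutside_comp (h ▸ hX) hX]
    refine hE_comp _ _ (isPartialBij_padOutside hR hRX (h ▸ hX))
      (isPartialBij_padOutside hS hX hSX) ?_
    rw [cod_padOutside, dom_padOutside, h]

/-- The image of a relation on `N` under a map. -/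
def transport (ι : N → N') (R : SetRel N N) : SetRel N' N' :=
  {p | ∃ a b, (a, b) ∈ R ∧ p = (ι a, ι b)}

theorem dom_transport (ι : N → N') (R : SetRel N N) : (transport ι R).dom = ι '' R.dom := by
  ext u
  constructor
  · rintro ⟨_, a, b, hab, ⟨⟩⟩
    exact ⟨a, ⟨b, hab⟩, rfl⟩
  · rintro ⟨a, ⟨b, hab⟩, rfl⟩
    exact ⟨ι b, a, b, hab, rfl⟩

theorem cod_transport (ι : N → N') (R : SetRel N N) : (transport ι R).cod = ι '' R.cod := by
  ext u
  constructor
  · rintro ⟨_, a, b, hab, ⟨⟩⟩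
    exact ⟨b, ⟨a, hab⟩, rfl⟩
  · rintro ⟨b, ⟨a, hab⟩, rfl⟩
    exact ⟨ι a, a, b, hab, rfl⟩

theorem transport_comp {ι : N → N'} (hι : Function.Injective ι) (R S : SetRel N N) :
    transport ι (R ○ S) = transport ι R ○ transport ι S := by
  ext ⟨x, z⟩
  constructor
  · rintro ⟨a, c, ⟨b, hab, hbc⟩, ⟨⟩⟩
    exact ⟨ι b, ⟨a, b, hab, rfl⟩, b, c, hbc, rfl⟩
  · rintro ⟨_, ⟨a, b, hab, ⟨⟩⟩, b', c, hbc, h⟩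
    obtain ⟨hb, rfl⟩ := Prod.ext_iff.1 h
    obtain rfl := hι hb
    exact ⟨a, c, ⟨b, hab, hbc⟩, rfl⟩

theorem IsPartialBij.transport {R : SetRel N N} (hR : IsPartialBij R) {ι : N → N'}
    (hι : Function.Injective ι) : IsPartialBij (transport ι R) := by
  rintro _ _ _ _ ⟨a, b, hab, ⟨⟩⟩ ⟨a', b', hab', ⟨⟩⟩
  rw [hι.eq_iff, hι.eq_iff]
  exact hR hab hab'

end PartialBijections

/-! ### Covers with parities -/

section LabelledPermutations

/-- Labelled permutations of `V`, that is, pairs of a label in `G` and a permutation of `V`, act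
on `V` by forgetting the label. -/
instance labelledPermVertexAction (G V : Type*) [Group G] : MulAction (G × Perm V) V :=
  MulAction.compHom V (MonoidHom.snd G (Perm V))

theorem labelled_smul_def {G V : Type*} [Group G] (p : G × Perm V) (v : V) : p • v = p.2 v :=
  rfl

/-- The group `H` of labelled permutations of `V` extends all admissible labelled partial
bijections of `A` (placed in `V` by `ι`) coherently. -/
def HasCoherentExtension {G A V : Type*} [Group G] (H : Subgroup (G × Perm V)) (ι : A → V)
    (Adm : G → SetRel A A → Prop) : Prop :=
  ∃ E : G → SetRel A A → Perm V,
    (∀ g R, Adm g R → (g, E g R) ∈ H ∧ ∀ x y, (x, y) ∈ R → E g R (ι x) = ι y) ∧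
    ∀ g R g' R', Adm g R → Adm g' R' → R.cod = R'.dom →
      E (g' * g) (R ○ R') = E g' R' * E g R

end LabelledPermutations

section Twist

variable {P X J Z : Type*} [Group P] [MulAction P X] [MulAction P J]

/-- The action of `p` on pairs of a point of `X` and a function `J → Z`, with the value of the
function at `j` permuted by `e j y`, where `y` is the new point. -/
def twist (p : P) (e : J → X → Perm Z) : Perm (X × (J → Z)) where
  toFun v := (p • v.1, fun j => e j (p • v.1) (v.2 (p⁻¹ • j)))
  invFun v := (p⁻¹ • v.1, fun j => (e (p • j) v.1)⁻¹ (v.2 (p • j)))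
  left_inv v := by simp
  right_inv v := by simp

theorem twist_apply (p : P) (e : J → X → Perm Z) (v : X × (J → Z)) :
    twist p e v = (p • v.1, fun j => e j (p • v.1) (v.2 (p⁻¹ • j))) :=
  rfl

theorem twist_one : twist (1 : P) (fun (_ : J) (_ : X) => (1 : Perm Z)) = 1 := by
  ext v <;> simp [twist_apply]

theorem twist_mul (p p' : P) (e e' : J → X → Perm Z) :
    twist p e * twist p' e' =
      twist (p * p') fun j y => e j y * e' (p⁻¹ • j) (p⁻¹ • y) := by
  ext v <;> simp [twist_apply, mul_smul]

theorem twist_inv (p : P) (e : J → X → Perm Z) :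
    (twist p e)⁻¹ = twist p⁻¹ fun j y => (e (p • j) (p • y))⁻¹ := by
  rw [inv_eq_iff_mul_eq_one, twist_mul]
  simp [twist_one]

end Twist

section Parity

variable {G A J : Type*} [Group G] [MulAction (G × Perm A) J]

/-- The labelled permutations of `A × (J → k)` which act on the functions by translations whose
values sum to zero over the support of each index. -/
def parityGroup (k : Type*) [AddCommGroup k] (supp : J → Finset A)
    (hsupp : ∀ (p : G × Perm A) j, supp (p • j) = (supp j).map p.2.toEmbedding) :
    Subgroup (G × Perm (A × (J → k))) where
  carrier := {h | ∃ (p : G × Perm A) (c : J → A → k), (∀ j, ∑ y ∈ supp j, c j y = 0) ∧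
    h = (p.1, twist p fun j y => Equiv.addRight (c j y))}
  one_mem' := ⟨1, 0, by simp, Prod.ext rfl (by simp [twist_one])⟩
  mul_mem' := by
    rintro _ _ ⟨p, c, hc, rfl⟩ ⟨p', c', hc', rfl⟩
    refine ⟨p * p', fun j y => c' (p⁻¹ • j) (p⁻¹ • y) + c j y, fun j => ?_, ?_⟩
    · have supp_eq : supp j = (supp (p⁻¹ • j)).map p.2.toEmbedding := by
        rw [← hsupp p, smul_inv_smul]
      rw [Finset.sum_add_distrib, hc, supp_eq, Finset.sum_map, add_zero]
      simpa [labelled_smul_def] using hc' (p⁻¹ • j)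
    · simp [twist_mul]
  inv_mem' := by
    rintro _ ⟨p, c, hc, rfl⟩
    refine ⟨p⁻¹, fun j y => -c (p • j) (p • y), fun j => ?_, by simp [twist_inv]⟩
    have sum_eq := hc (p • j)
    rw [hsupp, Finset.sum_map] at sum_eq
    simpa [labelled_smul_def] using sum_eq

variable {k : Type*} [Field k]

/-- Weights on `s` which equal `1` on `C` and sum to zero, unless `s` is contained in `C`. -/
noncomputable def weight (k : Type*) [Field k] (s : Finset A) (C : Set A) (y : A) : k :=
  open Classical in
  if y ∈ C then 1 else -((s.filter (· ∈ C)).card : k) / ((s.filter (· ∉ C)).card : k)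

theorem weight_of_mem (s : Finset A) {C : Set A} {y : A} (hy : y ∈ C) : weight k s C y = 1 :=
  if_pos hy

open Classical in
theorem weight_of_notMem (s : Finset A) {C : Set A} {y : A} (hy : y ∉ C) :
    weight k s C y = -((s.filter (· ∈ C)).card : k) / ((s.filter (· ∉ C)).card : k) :=
  if_neg hy

open Classical in
theorem sum_weight {s : Finset A} {C : Set A} (hs : ((s.filter (· ∉ C)).card : k) ≠ 0) :
    ∑ y ∈ s, weight k s C y = 0 := by
  have sum_inside : ∑ y ∈ s.filter (· ∈ C), weight k s C y = (s.filter (· ∈ C)).card := by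
    rw [Finset.sum_congr rfl fun y hy => weight_of_mem s (Finset.mem_filter.1 hy).2]
    simp
  have sum_outside : ∑ y ∈ s.filter (· ∉ C), weight k s C y = -(s.filter (· ∈ C)).card := by
    rw [Finset.sum_congr rfl fun y hy => weight_of_notMem s (Finset.mem_filter.1 hy).2,
      Finset.sum_const, nsmul_eq_mul, mul_div_cancel₀ _ hs]
  rw [← Finset.sum_filter_add_sum_filter_not s (· ∈ C), sum_inside, sum_outside, add_neg_cancel]

theorem weight_map (s : Finset A) {σ : Perm A} {C D : Set A} (h : ∀ y, σ y ∈ D ↔ y ∈ C) (y : A) :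
    weight k (s.map σ.toEmbedding) D (σ y) = weight k s C y := by
  classical
  simp only [weight, Finset.filter_map, Finset.card_map, Function.comp_def,
    Equiv.coe_toEmbedding, h]

/-- The lift of `p` to `A × (J → k)` which fixes the coordinate `γ` over the vertices of `C`. -/
noncomputable def correctedLift (supp : J → Finset A) (γ : J → k) (p : G × Perm A) (C : Set A) :
    Perm (A × (J → k)) :=
  twist p fun j y => Equiv.addRight ((γ j - γ (p⁻¹ • j)) * weight k (supp j) C y)

theorem correctedLift_apply_of_mem (supp : J → Finset A) (γ : J → k) {p : G × Perm A} {C : Set A}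
    {x : A} (hx : p • x ∈ C) : correctedLift supp γ p C (x, γ) = (p • x, γ) := by
  ext <;> simp [correctedLift, twist_apply, weight_of_mem _ hx]

theorem correctedLift_mul {supp : J → Finset A}
    (hsupp : ∀ (p : G × Perm A) j, supp (p • j) = (supp j).map p.2.toEmbedding) (γ : J → k)
    {p p' : G × Perm A} {C C' : Set A} (h : ∀ y, p' • y ∈ C' ↔ y ∈ C) :
    correctedLift supp γ p' C' * correctedLift supp γ p C =
      correctedLift supp γ (p' * p) C' := by
  have weight_eq (j : J) (y : A) :
      weight k (supp (p'⁻¹ • j)) C (p'⁻¹ • y) = weight k (supp j) C' y := by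
    rw [← weight_map (σ := p'.2) _ h, ← hsupp, ← labelled_smul_def, smul_inv_smul, smul_inv_smul]
  simp only [correctedLift, twist_mul]
  congr 1
  funext j y
  rw [weight_eq, ← Equiv.addRight_add, mul_inv_rev, mul_smul]
  congr 1
  ring

theorem correctedLift_mem_parityGroup {supp : J → Finset A}
    (hsupp : ∀ (p : G × Perm A) j, supp (p • j) = (supp j).map p.2.toEmbedding)
    (cast_ne_zero : ∀ s : Finset A, s.Nonempty → (s.card : k) ≠ 0) {γ : J → k} {g : G}
    {σ : Perm A} {C : Set A} (hγ : ∀ j, ↑(supp j) ⊆ C → γ ((g, σ)⁻¹ • j) = γ j) :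
    (g, correctedLift supp γ (g, σ) C) ∈ parityGroup k supp hsupp := by
  classical
  refine ⟨(g, σ), _, fun j => ?_, rfl⟩
  rw [← Finset.mul_sum]
  by_cases hj : ↑(supp j) ⊆ C
  · rw [hγ j hj, sub_self, zero_mul]
  · obtain ⟨y, hy, hyC⟩ := Set.not_subset.1 hj
    rw [sum_weight (cast_ne_zero _ ⟨y, Finset.mem_filter.2 ⟨hy, hyC⟩⟩), mul_zero]

theorem exists_perm_of_mem_parityGroup {supp : J → Finset A}
    {hsupp : ∀ (p : G × Perm A) j, supp (p • j) = (supp j).map p.2.toEmbedding}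
    (cast_ne_zero : ∀ s : Finset A, s.Nonempty → (s.card : k) ≠ 0) (γ : J → k)
    {h : G × Perm (A × (J → k))} (hh : h ∈ parityGroup k supp hsupp) :
    ∃ σ : Perm A, (∀ a b, h.2 (a, γ) = (b, γ) → σ a = b) ∧
      ∀ j, (supp j).Nonempty → (∀ a ∈ supp j, ∃ b, h.2 (a, γ) = (b, γ)) →
        γ ((h.1, σ) • j) = γ j := by
  obtain ⟨⟨g, σ⟩, c, hc, rfl⟩ := hh
  refine ⟨σ, fun a b hab => ?_, fun j hj hrange => ?_⟩
  · exact congrArg Prod.fst hab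
  · have translation_eq : ∀ y ∈ supp ((g, σ) • j),
        c ((g, σ) • j) y = γ ((g, σ) • j) - γ j := by
      intro y hy
      rw [hsupp] at hy
      obtain ⟨a, ha, rfl⟩ := Finset.mem_map.1 hy
      obtain ⟨b, hb⟩ := hrange a ha
      have value_eq := congrFun (congrArg Prod.snd hb) ((g, σ) • j)
      simp only [twist_apply, inv_smul_smul, Equiv.coe_addRight] at value_eq
      exact eq_sub_of_add_eq' value_eq
    have sum_eq := hc ((g, σ) • j)
    rw [Finset.sum_congr rfl translation_eq, Finset.sum_const, nsmul_eq_mul, mul_eq_zero] at sum_eq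
    refine sub_eq_zero.1 (sum_eq.resolve_left (cast_ne_zero _ ?_))
    rwa [hsupp, Finset.map_nonempty]

theorem exists_prime_card_cast_ne_zero (A : Type*) [Finite A] :
    ∃ p : ℕ, p.Prime ∧ ∀ s : Finset A, s.Nonempty → (s.card : ZMod p) ≠ 0 := by
  have := Fintype.ofFinite A
  obtain ⟨p, hp, hprime⟩ := Nat.exists_infinite_primes (Fintype.card A + 1)
  refine ⟨p, hprime, fun s hs h => ?_⟩
  have p_le := Nat.le_of_dvd (Finset.card_pos.2 hs) ((ZMod.natCast_eq_zero_iff _ _).1 h)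
  have card_le := Finset.card_le_univ s
  omega

theorem hasCoherentExtension_parityGroup [Finite A] {supp : J → Finset A}
    (hsupp : ∀ (p : G × Perm A) j, supp (p • j) = (supp j).map p.2.toEmbedding)
    (cast_ne_zero : ∀ s : Finset A, s.Nonempty → (s.card : k) ≠ 0) (γ : J → k)
    (Adm : G → SetRel A A → Prop) (hAdm : ∀ g R, Adm g R → IsPartialBij R)
    (hγ : ∀ g R, Adm g R → ∀ σ : Perm A, (∀ x y, (x, y) ∈ R → σ x = y) →
      ∀ j, ↑(supp j) ⊆ R.dom → γ ((g, σ) • j) = γ j) :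
    HasCoherentExtension (parityGroup k supp hsupp) (fun a => (a, γ)) Adm := by
  obtain ⟨E, hE, hE_comp⟩ := exists_coherent_extension A
  refine ⟨fun g R => correctedLift supp γ (g, E R) R.cod, fun g R hR => ⟨?_, fun x y hxy => ?_⟩,
    fun g R g' R' hR hR' hcod => ?_⟩
  · refine correctedLift_mem_parityGroup hsupp cast_ne_zero fun j hj => ?_
    rw [← hγ g R hR (E R) (hE R (hAdm g R hR)), smul_inv_smul]
    intro x hx
    rw [← apply_mem_cod_iff_mem_dom (hE R (hAdm g R hR))]
    apply hj
    rw [← smul_inv_smul (g, E R) j, hsupp]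
    exact Finset.mem_map_of_mem _ hx
  · have apply_eq : (g, E R) • x = y := hE R (hAdm g R hR) x y hxy
    rw [correctedLift_apply_of_mem _ _ (apply_eq ▸ ⟨x, hxy⟩), apply_eq]
  · beta_reduce
    rw [correctedLift_mul hsupp, hE_comp R R' (hAdm g R hR) (hAdm g' R' hR') hcod,
      cod_comp_of_cod_eq_dom hcod]
    · rfl
    · rw [hcod]
      exact apply_mem_cod_iff_mem_dom (hE R' (hAdm g' R' hR'))

theorem exists_parity_cover.{u₁, u₂} {A : Type u₁} {J : Type u₂} [MulAction (G × Perm A) J]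
    [Finite A] [Finite J] (supp : J → Finset A)
    (hsupp : ∀ (p : G × Perm A) j, supp (p • j) = (supp j).map p.2.toEmbedding)
    (good : J → Prop) (Adm : G → SetRel A A → Prop)
    (hAdm : ∀ g R, Adm g R → IsPartialBij R)
    (hgood : ∀ g R, Adm g R → ∀ σ : Perm A, (∀ x y, (x, y) ∈ R → σ x = y) →
      ∀ j, ↑(supp j) ⊆ R.dom → (good ((g, σ) • j) ↔ good j)) :
    ∃ (V : Type (max u₁ u₂)) (_ : Finite V) (H : Subgroup (G × Perm V)) (ι : A → V),
      Function.Injective ι ∧ HasCoherentExtension H ι Adm ∧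
      ∀ h ∈ H, ∃ σ : Perm A, (∀ a b, h.2 (ι a) = ι b → σ a = b) ∧
        ∀ j, (supp j).Nonempty → (∀ a ∈ supp j, h.2 (ι a) ∈ Set.range ι) →
          (good ((h.1, σ) • j) ↔ good j) := by
  classical
  obtain ⟨p, hp, cast_ne_zero⟩ := exists_prime_card_cast_ne_zero A
  have : Fact p.Prime := ⟨hp⟩
  let γ (j : J) : ZMod p := if good j then 1 else 0
  have γ_eq_iff (i j : J) : γ i = γ j ↔ (good i ↔ good j) := by
    by_cases hi : good i <;> by_cases hj : good j <;> simp [γ, hi, hj]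
  refine ⟨A × (J → ZMod p), inferInstance, parityGroup (ZMod p) supp hsupp,
    fun a => (a, γ), fun a b h => congrArg Prod.fst h,
    hasCoherentExtension_parityGroup hsupp cast_ne_zero γ Adm hAdm
      fun g R hR σ hσ j hj => (γ_eq_iff _ _).2 (hgood g R hR σ hσ j hj), fun h hh => ?_⟩
  obtain ⟨σ, hσ, σ_preserves⟩ := exists_perm_of_mem_parityGroup cast_ne_zero γ hh
  refine ⟨σ, hσ, fun j hj hrange => (γ_eq_iff _ _).1 (σ_preserves j hj fun a ha => ?_)⟩
  obtain ⟨b, hb⟩ := hrange a ha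
  exact ⟨b, hb.symm⟩

end Parity

/-! ### Conformal covers -/

section Conformal

variable {G A V : Type*} [Group G] {H : Subgroup (G × Perm V)} {ι : A → V}

/-- Some element of `H` moves the set `S` into the range of `ι`. -/
def IsTranslatable (H : Subgroup (G × Perm V)) (ι : A → V) (S : Set V) : Prop :=
  ∃ h ∈ H, ∀ v ∈ S, h • v ∈ Set.range ι

/-- A set is translatable as soon as all pairs of its elements are. -/
def IsConformal (H : Subgroup (G × Perm V)) (ι : A → V) : Prop :=
  ∀ S : Set V, (∀ u ∈ S, ∀ v ∈ S, IsTranslatable H ι {u, v}) → IsTranslatable H ι S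

theorem isTranslatable_smul_iff {h : G × Perm V} (hh : h ∈ H) (S : Set V) :
    IsTranslatable H ι (h • S) ↔ IsTranslatable H ι S := by
  constructor
  · rintro ⟨g, hg, hS⟩
    refine ⟨g * h, H.mul_mem hg hh, fun v hv => ?_⟩
    rw [mul_smul]
    exact hS _ (Set.smul_mem_smul_set hv)
  · rintro ⟨g, hg, hS⟩
    refine ⟨g * h⁻¹, H.mul_mem hg (H.inv_mem hh), ?_⟩
    rintro _ ⟨v, hv, rfl⟩
    rw [mul_smul]
    exact (inv_smul_smul h v).symm ▸ hS v hv

/-- The vertices of the conformal cover: a vertex of `V` together with a colour at each set. Only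
those which satisfy `IsValued` matter. -/
abbrev Coloured (V : Type*) : Type _ :=
  V × (Set V → Option (Fin (Nat.card V)))

/-- The colours available at `M`. There are fewer of them than elements of `M`. -/
def palette (M : Set V) : Set (Fin (Nat.card V)) :=
  {i | i + 1 < M.ncard}

theorem palette_smul (h : G × Perm V) (M : Set V) : palette (h • M) = palette M := by
  have := Set.ncard_image_of_injective M (MulAction.injective h)
  simp only [palette, Set.image_smul] at this ⊢
  rw [this]

theorem ncard_palette_add_one [Finite V] {M : Set V} (hM : M.Nonempty) :
    (palette M).ncard + 1 = M.ncard := by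
  have palette_eq : palette M = Fin.val ⁻¹' Set.Iio (M.ncard - 1) := by
    ext i
    simp only [palette, Set.mem_ofPred_eq, Set.mem_preimage, Set.mem_Iio]
    omega
  have le_card : M.ncard ≤ Nat.card V := M.ncard_le_card
  rw [palette_eq, Set.ncard_preimage_of_injective_subset_range Fin.val_injective, Set.ncard_Iio_nat]
  · have := (Set.ncard_pos M.toFinite).2 hM
    omega
  · intro i hi
    exact ⟨⟨i, by have := Set.mem_Iio.1 hi; omega⟩, rfl⟩

/-- The coloured vertex `u` has colours exactly at the sets which contain it and are not
translatable, and these are taken from the palettes of the sets. -/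
def IsValued (H : Subgroup (G × Perm V)) (ι : A → V) (u : Coloured V) : Prop :=
  ∀ M, ((u.2 M).isSome ↔ ¬ IsTranslatable H ι M ∧ u.1 ∈ M) ∧ ∀ i ∈ u.2 M, i ∈ palette M

/-- No two elements of `S` share a colour at any set. -/
def IsSeparated (S : Set (Coloured V)) : Prop :=
  ∀ M, ∀ u ∈ S, ∀ v ∈ S, ∀ i, i ∈ u.2 M → i ∈ v.2 M → u = v

/-- The labelled permutations of coloured vertices which lie over elements of `H` and permute the
palettes of the sets. -/
def valueGroup (H : Subgroup (G × Perm V)) : Subgroup (G × Perm (Coloured V)) where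
  carrier := {k | ∃ h ∈ H, ∃ ε : Set V → Perm (Fin (Nat.card V)),
    (∀ M, ε M ∈ MulAction.stabilizer (Perm (Fin (Nat.card V))) (palette M)) ∧
    k = (h.1, twist h fun M _ => (ε M).optionCongr)}
  one_mem' := by
    refine ⟨1, H.one_mem, 1, fun M => one_mem _, Prod.ext rfl ?_⟩
    simp only [Pi.one_apply, Equiv.optionCongr_one, twist_one, Prod.snd_one]
  mul_mem' := by
    rintro _ _ ⟨h, hh, ε, hε, rfl⟩ ⟨h', hh', ε', hε', rfl⟩
    refine ⟨h * h', H.mul_mem hh hh', fun M => ε M * ε' (h⁻¹ • M),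
      fun M => mul_mem (hε M) (palette_smul h⁻¹ M ▸ hε' _), Prod.ext rfl ?_⟩
    simp only [Prod.mk_mul_mk, twist_mul]
    congr 1
    funext M _
    exact (Equiv.optionCongr_trans (ε' _) (ε M)).symm
  inv_mem' := by
    rintro _ ⟨h, hh, ε, hε, rfl⟩
    refine ⟨h⁻¹, H.inv_mem hh, fun M => (ε (h • M))⁻¹,
      fun M => inv_mem (palette_smul h M ▸ hε _), Prod.ext rfl ?_⟩
    simp only [Prod.inv_mk, twist_inv]
    rfl

theorem IsValued.isSome_iff {h : G × Perm V} (hh : h ∈ H) {u w : Coloured V}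
    (hu : IsValued H ι u) (hw : IsValued H ι w) (huw : w.1 = h • u.1) (M : Set V) :
    (u.2 (h⁻¹ • M)).isSome ↔ (w.2 M).isSome := by
  rw [(hu _).1, (hw _).1, isTranslatable_smul_iff (H.inv_mem hh), huw, Set.mem_inv_smul_set_iff]

theorem IsValued.of_smul {k : G × Perm (Coloured V)} (hk : k ∈ valueGroup H) {u : Coloured V}
    (hu : IsValued H ι (k • u)) : IsValued H ι u := by
  obtain ⟨h, hh, ε, hε, rfl⟩ := hk
  intro M
  have at_smul := hu (h • M)
  rw [labelled_smul_def, twist_apply] at at_smul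
  simp only [inv_smul_smul, isTranslatable_smul_iff hh, Set.smul_mem_smul_set_iff,
    palette_smul] at at_smul
  refine ⟨by simpa using at_smul.1, fun i hi => ?_⟩
  have colour_mem := at_smul.2 (ε (h • M) i) (by simpa using hi)
  have stab := hε (h • M)
  rw [palette_smul, MulAction.mem_stabilizer_set] at stab
  exact (stab i).1 colour_mem

/-- The partial map of colours at `M` induced by a partial map `Q` of coloured vertices which
lies over `h`. -/
def colourRel (Q : SetRel (Coloured V) (Coloured V)) (h : G × Perm V) (M : Set V) :
    SetRel (Fin (Nat.card V)) (Fin (Nat.card V)) :=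
  {p | ∃ u w, (u, w) ∈ Q ∧ p.1 ∈ u.2 (h⁻¹ • M) ∧ p.2 ∈ w.2 M}

/-- `Q` is a partial bijection over `h` between separated sets of valued vertices. -/
structure IsPartialLift (H : Subgroup (G × Perm V)) (ι : A → V) (h : G × Perm V)
    (Q : SetRel (Coloured V) (Coloured V)) : Prop where
  isPartialBij : IsPartialBij Q
  fst_eq : ∀ u w, (u, w) ∈ Q → w.1 = h • u.1
  isValued_dom : ∀ u ∈ Q.dom, IsValued H ι u
  isValued_cod : ∀ w ∈ Q.cod, IsValued H ι w
  isSeparated_dom : IsSeparated Q.dom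
  isSeparated_cod : IsSeparated Q.cod

namespace IsPartialLift

variable {h h' : G × Perm V} {Q Q' : SetRel (Coloured V) (Coloured V)}

theorem isPartialBij_colourRel (hQ : IsPartialLift H ι h Q) (M : Set V) :
    IsPartialBij (colourRel Q h M) := by
  rintro i j i' j' ⟨u, w, huw, hi, hj⟩ ⟨u', w', huw', hi', hj'⟩
  constructor
  · rintro rfl
    obtain rfl := hQ.isSeparated_dom _ u ⟨w, huw⟩ u' ⟨w', huw'⟩ i hi hi'
    obtain rfl := (hQ.isPartialBij huw huw').1 rfl
    exact Option.mem_unique hj hj'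
  · rintro rfl
    obtain rfl := hQ.isSeparated_cod _ w ⟨u, huw⟩ w' ⟨u', huw'⟩ j hj hj'
    obtain rfl := (hQ.isPartialBij huw huw').2 rfl
    exact Option.mem_unique hi hi'

theorem dom_colourRel_subset (hQ : IsPartialLift H ι h Q) (M : Set V) :
    (colourRel Q h M).dom ⊆ palette M := by
  rintro i ⟨j, u, w, huw, hi, -⟩
  rw [← palette_smul h⁻¹]
  exact (hQ.isValued_dom u ⟨w, huw⟩ _).2 i hi

theorem cod_colourRel_subset (hQ : IsPartialLift H ι h Q) (M : Set V) :
    (colourRel Q h M).cod ⊆ palette M := by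
  rintro j ⟨i, u, w, huw, -, hj⟩
  exact (hQ.isValued_cod w ⟨u, huw⟩ _).2 j hj

theorem isSome_iff (hh : h ∈ H) (hQ : IsPartialLift H ι h Q) {u w : Coloured V}
    (huw : (u, w) ∈ Q) (M : Set V) : (u.2 (h⁻¹ • M)).isSome ↔ (w.2 M).isSome :=
  (hQ.isValued_dom u ⟨w, huw⟩).isSome_iff hh (hQ.isValued_cod w ⟨u, huw⟩) (hQ.fst_eq u w huw) M

theorem cod_colourRel_eq_dom (hh : h ∈ H) (hh' : h' ∈ H) (hQ : IsPartialLift H ι h Q)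
    (hQ' : IsPartialLift H ι h' Q') (hcod : Q.cod = Q'.dom) (M : Set V) :
    (colourRel Q h (h'⁻¹ • M)).cod = (colourRel Q' h' M).dom := by
  ext j
  constructor
  · rintro ⟨i, u, v, huv, -, hj⟩
    obtain ⟨w, hvw⟩ : v ∈ Q'.dom := hcod ▸ ⟨u, huv⟩
    obtain ⟨k, hk⟩ :=
      Option.isSome_iff_exists.1 ((hQ'.isSome_iff hh' hvw M).1 (Option.isSome_of_mem hj))
    exact ⟨k, v, w, hvw, hj, hk⟩
  · rintro ⟨k, v, w, hvw, hj, -⟩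
    obtain ⟨u, huv⟩ : v ∈ Q.cod := hcod ▸ ⟨w, hvw⟩
    obtain ⟨i, hi⟩ :=
      Option.isSome_iff_exists.1 ((hQ.isSome_iff hh huv _).2 (Option.isSome_of_mem hj))
    exact ⟨i, u, v, huv, hi, hj⟩

theorem colourRel_comp (hh' : h' ∈ H) (hQ : IsPartialLift H ι h Q)
    (hQ' : IsPartialLift H ι h' Q') (hcod : Q.cod = Q'.dom) (M : Set V) :
    colourRel (Q ○ Q') (h' * h) M = colourRel Q h (h'⁻¹ • M) ○ colourRel Q' h' M := by
  ext ⟨i, k⟩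
  simp only [colourRel, mul_inv_rev, mul_smul]
  constructor
  · rintro ⟨u, w, ⟨v, huv, hvw⟩, hi, hk⟩
    obtain ⟨j, hj⟩ :=
      Option.isSome_iff_exists.1 ((hQ'.isSome_iff hh' hvw M).2 (Option.isSome_of_mem hk))
    exact ⟨j, ⟨u, v, huv, hi, hj⟩, v, w, hvw, hj, hk⟩
  · rintro ⟨j, ⟨u, v, huv, hi, hj⟩, v', w, hvw, hj', hk⟩
    obtain rfl := hQ.isSeparated_cod _ v ⟨u, huv⟩ v' (hcod ▸ ⟨w, hvw⟩) j hj hj'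
    exact ⟨u, w, ⟨v, huv, hvw⟩, hi, hk⟩

end IsPartialLift

theorem exists_coherent_lift (H : Subgroup (G × Perm V)) (ι : A → V) :
    ∃ F : G × Perm V → SetRel (Coloured V) (Coloured V) → Perm (Coloured V),
      (∀ h ∈ H, ∀ Q, IsPartialLift H ι h Q →
        (h.1, F h Q) ∈ valueGroup H ∧ ∀ u w, (u, w) ∈ Q → F h Q u = w) ∧
      ∀ h ∈ H, ∀ h' ∈ H, ∀ Q Q', IsPartialLift H ι h Q → IsPartialLift H ι h' Q' →
        Q.cod = Q'.dom → F (h' * h) (Q ○ Q') = F h' Q' * F h Q := by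
  obtain ⟨E, hE, hE_comp⟩ := exists_coherent_extension_on (Fin (Nat.card V))
  refine ⟨fun h Q => twist h fun M _ => (E (palette M) (colourRel Q h M)).optionCongr,
    fun h hh Q hQ => ?_, fun h hh h' hh' Q Q' hQ hQ' hcod => ?_⟩
  · have hE_colourRel (M : Set V) := hE (palette M) _ (hQ.isPartialBij_colourRel M)
      (hQ.dom_colourRel_subset M) (hQ.cod_colourRel_subset M)
    refine ⟨⟨h, hh, _, fun M => (hE_colourRel M).1, rfl⟩, fun u w huw => ?_⟩
    refine Prod.ext (hQ.fst_eq u w huw).symm (funext fun M => ?_)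
    have isSome_iff := hQ.isSome_iff hh huw M
    change Option.map _ (u.2 (h⁻¹ • M)) = w.2 M
    cases hu : u.2 (h⁻¹ • M) with
    | none =>
      rw [hu] at isSome_iff
      simpa [eq_comm (a := none)] using isSome_iff
    | some i =>
      obtain ⟨j, hj⟩ := Option.isSome_iff_exists.1 (isSome_iff.1 (hu ▸ rfl))
      rw [Option.map_some, hj, (hE_colourRel M).2 i j ⟨u, w, huw, hu, hj⟩]
  · simp only [twist_mul]
    congr 1
    funext M v
    rw [hQ.colourRel_comp hh' hQ' hcod, hE_comp _ _ _ (hQ.isPartialBij_colourRel _)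
      (hQ'.isPartialBij_colourRel M) (palette_smul h'⁻¹ M ▸ hQ.dom_colourRel_subset _)
      (hQ.cod_colourRel_eq_dom hh hh' hQ' hcod M) (hQ'.dom_colourRel_subset M)
      (hQ'.cod_colourRel_subset M), palette_smul]
    exact Equiv.optionCongr_trans _ _

theorem exists_colouring [Finite V] {M : Set V} (hM : ¬ IsTranslatable H ι M) :
    ∃ c : V → Fin (Nat.card V), Set.range ι ∩ M ⊆ c ⁻¹' palette M ∧
      Set.InjOn c (Set.range ι ∩ M) := by
  have not_subset : ¬ M ⊆ Set.range ι := fun h => hM ⟨1, H.one_mem, fun v hv => h hv⟩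
  obtain ⟨v, hv, -⟩ := Set.not_subset.1 not_subset
  have : Nonempty (Fin (Nat.card V)) := ⟨⟨0, Nat.card_pos_iff.2 ⟨⟨v⟩, inferInstance⟩⟩⟩
  refine (Set.toFinite _).exists_injOn_of_encard_le ?_
  have ncard_lt : (Set.range ι ∩ M).ncard < M.ncard :=
    Set.ncard_lt_ncard ⟨Set.inter_subset_right, fun h => not_subset fun v hv => (h hv).1⟩
      M.toFinite
  have ncard_palette := ncard_palette_add_one ⟨v, hv⟩
  rw [← (Set.toFinite _).cast_ncard_eq, ← (Set.toFinite _).cast_ncard_eq]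
  exact_mod_cast (by omega : (Set.range ι ∩ M).ncard ≤ (palette M).ncard)

theorem exists_valued_lift [Finite V] (H : Subgroup (G × Perm V)) (ι : A → V) :
    ∃ ι' : A → Coloured V, (∀ a, (ι' a).1 = ι a) ∧ (∀ a, IsValued H ι (ι' a)) ∧
      IsSeparated (Set.range ι') := by
  classical
  have colouring (M : Set V) : ∃ c : V → Fin (Nat.card V), ¬ IsTranslatable H ι M →
      Set.range ι ∩ M ⊆ c ⁻¹' palette M ∧ Set.InjOn c (Set.range ι ∩ M) := by
    by_cases hM : IsTranslatable H ι M
    · exact ⟨fun v => ⟨0, Nat.card_pos_iff.2 ⟨⟨v⟩, inferInstance⟩⟩, fun h => absurd hM h⟩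
    · obtain ⟨c, hc⟩ := exists_colouring hM
      exact ⟨c, fun _ => hc⟩
  choose c hc using colouring
  refine ⟨fun a => (ι a, fun M => if ¬ IsTranslatable H ι M ∧ ι a ∈ M then some (c M (ι a))
    else none), fun a => rfl, fun a M => ?_, ?_⟩
  · dsimp only
    split_ifs with h
    · refine ⟨iff_of_true rfl h, fun i hi => ?_⟩
      obtain rfl := Option.mem_some.1 hi
      exact (hc M h.1).1 ⟨⟨a, rfl⟩, h.2⟩
    · exact ⟨iff_of_false Bool.false_ne_true h, fun i hi => nomatch hi⟩
  · rintro M _ ⟨a, rfl⟩ _ ⟨b, rfl⟩ i hi hi'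
    simp only [Option.mem_def, Option.ite_none_right_eq_some, Option.some_inj] at hi hi'
    have ι_eq : ι a = ι b :=
      (hc M hi.1.1).2 ⟨⟨a, rfl⟩, hi.1.2⟩ ⟨⟨b, rfl⟩, hi'.1.2⟩ (hi.2.trans hi'.2.symm)
    simp only [ι_eq]

section

variable {ι' : A → Coloured V}

theorem IsSeparated.of_isTranslatable_pair (hι' : IsSeparated (Set.range ι')) {S : Set (Coloured V)}
    (hS : ∀ u ∈ S, ∀ v ∈ S, IsTranslatable (valueGroup H) ι' {u, v}) : IsSeparated S := by
  intro M u hu v hv i hi hi'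
  obtain ⟨_, ⟨h, -, ε, -, rfl⟩, hk⟩ := hS u hu v hv
  obtain ⟨hku, hkv⟩ := Set.pair_subset_iff.1 hk
  refine (MulAction.injective _) (hι' (h • M) _ hku _ hkv (ε (h • M) i) ?_ ?_) <;>
    simpa [labelled_smul_def, twist_apply]

theorem injOn_fst_of_isTranslatable_pair (ι'_injOn : Set.InjOn Prod.fst (Set.range ι'))
    {S : Set (Coloured V)}
    (hS : ∀ u ∈ S, ∀ v ∈ S, IsTranslatable (valueGroup H) ι' {u, v}) : Set.InjOn Prod.fst S := by
  intro u hu v hv huv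
  obtain ⟨_, ⟨h, -, ε, -, rfl⟩, hk⟩ := hS u hu v hv
  obtain ⟨hku, hkv⟩ := Set.pair_subset_iff.1 hk
  exact MulAction.injective _ (ι'_injOn hku hkv (congrArg (h • ·) huv))

theorem isTranslatable_image_fst [Finite V] {S : Set (Coloured V)}
    (hS : ∀ u ∈ S, IsValued H ι u) (hS_sep : IsSeparated S) (hS_inj : Set.InjOn Prod.fst S) :
    IsTranslatable H ι (Prod.fst '' S) := by
  by_contra hbad
  have colour_isSome (u : Coloured V) (hu : u ∈ S) : ∃ i, u.2 (Prod.fst '' S) = some i :=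
    Option.isSome_iff_exists.1 ((hS u hu _).1.2 ⟨hbad, u, hu, rfl⟩)
  have ncard_le : S.ncard ≤ (some '' palette (Prod.fst '' S)).ncard := by
    refine Set.ncard_le_ncard_of_injOn (fun u => u.2 (Prod.fst '' S)) (fun u hu => ?_)
      (fun u hu v hv huv => ?_) (Set.toFinite _)
    · obtain ⟨i, hi⟩ := colour_isSome u hu
      exact ⟨i, (hS u hu _).2 i hi, hi.symm⟩
    · obtain ⟨i, hi⟩ := colour_isSome u hu
      exact hS_sep _ u hu v hv i hi (huv.symm.trans hi)
  rw [Set.ncard_image_of_injective _ (Option.some_injective _)] at ncard_le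
  have image_nonempty : (Prod.fst '' S).Nonempty := by
    rw [Set.nonempty_iff_ne_empty]
    intro h
    exact hbad ⟨1, H.one_mem, by simp [h]⟩
  have ncard_palette := ncard_palette_add_one image_nonempty
  rw [hS_inj.ncard_image] at ncard_palette
  omega

theorem isConformal_valueGroup [Finite V] (hι : Function.Injective ι)
    (ι'_fst : ∀ a, (ι' a).1 = ι a) (ι'_valued : ∀ a, IsValued H ι (ι' a))
    (ι'_sep : IsSeparated (Set.range ι')) : IsConformal (valueGroup H) ι' := by
  intro S hS
  have S_sep := ι'_sep.of_isTranslatable_pair hS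
  have ι'_injOn : Set.InjOn Prod.fst (Set.range ι') := by
    rintro _ ⟨a, rfl⟩ _ ⟨b, rfl⟩ h
    rw [ι'_fst, ι'_fst] at h
    rw [hι h]
  have S_inj := injOn_fst_of_isTranslatable_pair ι'_injOn hS
  have S_valued : ∀ u ∈ S, IsValued H ι u := by
    intro u hu
    obtain ⟨k, hk, hku⟩ := hS u hu u hu
    obtain ⟨a, ha⟩ := hku u (Set.mem_insert _ _)
    exact IsValued.of_smul hk (ha ▸ ι'_valued a)
  obtain ⟨h, hh, hS'⟩ := isTranslatable_image_fst S_valued S_sep S_inj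
  let Q : SetRel (Coloured V) (Coloured V) := {p | p.1 ∈ S ∧ ∃ a, p.2 = ι' a ∧ ι a = h • p.1.1}
  have dom_subset : Q.dom ⊆ S := fun _ ⟨_, hu, _⟩ => hu
  have cod_subset : Q.cod ⊆ Set.range ι' := fun w ⟨u, _, a, ha, _⟩ => ⟨a, ha.symm⟩
  have isPartialLift : IsPartialLift H ι h Q := by
    refine ⟨?_, ?_, fun u hu => S_valued u (dom_subset hu), ?_,
      fun M u hu v hv => S_sep M u (dom_subset hu) v (dom_subset hv),
      fun M u hu v hv => ι'_sep M u (cod_subset hu) v (cod_subset hv)⟩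
    · rintro u _ u' _ ⟨hu, a, ⟨⟩, ha⟩ ⟨hu', a', ⟨⟩, ha'⟩
      rw [← S_inj.eq_iff hu hu', ← (MulAction.injective h).eq_iff, ← ha, ← ha', hι.eq_iff]
      exact ⟨fun e => e ▸ rfl, fun e => hι (by rw [← ι'_fst, ← ι'_fst, e])⟩
    · rintro u _ ⟨-, a, ⟨⟩, ha⟩
      rw [ι'_fst, ha]
    · rintro w hw
      obtain ⟨a, rfl⟩ := cod_subset hw
      exact ι'_valued a
  obtain ⟨F, hF, -⟩ := exists_coherent_lift H ι
  obtain ⟨F_mem, F_apply⟩ := hF h hh Q isPartialLift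
  refine ⟨_, F_mem, fun u hu => ?_⟩
  obtain ⟨a, ha⟩ := hS' u.1 ⟨u, hu, rfl⟩
  exact ⟨a, (F_apply u (ι' a) ⟨hu, a, rfl, ha⟩).symm⟩

theorem hasCoherentExtension_valueGroup {Adm : G → SetRel A A → Prop}
    (hAdm : ∀ g R, Adm g R → IsPartialBij R) (hExt : HasCoherentExtension H ι Adm)
    (ι'_fst : ∀ a, (ι' a).1 = ι a) (ι'_inj : Function.Injective ι')
    (ι'_valued : ∀ a, IsValued H ι (ι' a)) (ι'_sep : IsSeparated (Set.range ι')) :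
    HasCoherentExtension (valueGroup H) ι' Adm := by
  obtain ⟨E, hE, hE_comp⟩ := hExt
  obtain ⟨F, hF, hF_comp⟩ := exists_coherent_lift H ι
  have isPartialLift (g : G) (R : SetRel A A) (hR : Adm g R) :
      IsPartialLift H ι (g, E g R) (transport ι' R) := by
    have range_dom := (dom_transport ι' R).trans_subset (Set.image_subset_range _ _)
    have range_cod := (cod_transport ι' R).trans_subset (Set.image_subset_range _ _)
    refine ⟨(hAdm g R hR).transport ι'_inj, ?_, fun u hu => ?_, fun u hu => ?_,
      fun M u hu v hv => ι'_sep M u (range_dom hu) v (range_dom hv),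
      fun M u hu v hv => ι'_sep M u (range_cod hu) v (range_cod hv)⟩
    · rintro _ _ ⟨a, b, hab, ⟨⟩⟩
      rw [ι'_fst, ι'_fst]
      exact ((hE g R hR).2 a b hab).symm
    · obtain ⟨a, rfl⟩ := range_dom hu
      exact ι'_valued a
    · obtain ⟨a, rfl⟩ := range_cod hu
      exact ι'_valued a
  refine ⟨fun g R => F (g, E g R) (transport ι' R), fun g R hR => ?_,
    fun g R g' R' hR hR' hcod => ?_⟩
  · obtain ⟨F_mem, F_apply⟩ := hF _ (hE g R hR).1 _ (isPartialLift g R hR)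
    exact ⟨F_mem, fun x y hxy => F_apply _ _ ⟨x, y, hxy, rfl⟩⟩
  · have cod_eq_dom : (transport ι' R).cod = (transport ι' R').dom := by
      rw [cod_transport, dom_transport, hcod]
    beta_reduce
    rw [← hF_comp _ (hE g R hR).1 _ (hE g' R' hR').1 _ _ (isPartialLift g R hR)
      (isPartialLift g' R' hR') cod_eq_dom, hE_comp g R g' R' hR hR' hcod, transport_comp ι'_inj]
    rfl

end

theorem exists_conformal_cover [Finite V] (hι : Function.Injective ι)
    (Adm : G → SetRel A A → Prop) (hAdm : ∀ g R, Adm g R → IsPartialBij R)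
    (hExt : HasCoherentExtension H ι Adm) :
    ∃ (H' : Subgroup (G × Perm (Coloured V))) (ι' : A → Coloured V),
      HasCoherentExtension H' ι' Adm ∧ (∀ a, (ι' a).1 = ι a) ∧
      (∀ k ∈ H', ∃ τ, (k.1, τ) ∈ H ∧ ∀ u, (k.2 u).1 = τ u.1) ∧ IsConformal H' ι' := by
  obtain ⟨ι', ι'_fst, ι'_valued, ι'_sep⟩ := exists_valued_lift H ι
  have ι'_inj : Function.Injective ι' := fun a b h => hι (by rw [← ι'_fst, h, ι'_fst])
  refine ⟨valueGroup H, ι', hasCoherentExtension_valueGroup hAdm hExt ι'_fst ι'_inj ι'_valued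
    ι'_sep, ι'_fst, ?_, isConformal_valueGroup hι ι'_fst ι'_valued ι'_sep⟩
  rintro _ ⟨h, hh, ε, -, rfl⟩
  exact ⟨h.2, hh, fun u => rfl⟩

end Conformal

/-! ### Covers inducing partial automorphisms -/

section Relabelling

variable {L : UnaryLanguage.{u, v}} {Γ : Subgroup L.Perm} {V : Type w}

/-- The action of pairs of a permutation of the language and a permutation of the vertices by
renaming symbols and vertices simultaneously. -/
instance labelledPermAction (Γ : Subgroup L.Perm) (V : Type w) :
    MulAction (Γ × Perm V) (Interp L V) where
  smul p S :=
    { rel := fun n r => p • S.rel n (p.1⁻¹.1.1 n r)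
      fn := fun F x => p • S.fn (p.1⁻¹.1.2 F) (p⁻¹ • x) }
  one_smul S := by
    refine Interp.ext (funext₂ fun n r => one_smul _ _) (funext₂ fun F x => ?_)
    exact (one_smul _ _).trans (by rw [inv_one, one_smul]; rfl)
  mul_smul p q S := by
    have lang_inv : (p * q).1⁻¹ = q.1⁻¹ * p.1⁻¹ := mul_inv_rev p.1 q.1
    refine Interp.ext (funext₂ fun n r => ?_) (funext₂ fun F x => ?_)
    · change (p * q) • S.rel n _ = p • q • S.rel n _
      rw [mul_smul, lang_inv]
      rfl
    · change (p * q) • S.fn _ _ = p • q • S.fn _ _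
      rw [mul_smul, lang_inv, mul_inv_rev, mul_smul]
      rfl

theorem smul_mem_smul_rel_iff (p : Γ × Perm V) (S : Interp L V) {n} (r : L.Rel n)
    (x : Fin n → V) : p • x ∈ (p • S).rel n (p.1.1.1 n r) ↔ x ∈ S.rel n r := by
  change p • x ∈ p • S.rel n ((p.1.1.1 n).symm (p.1.1.1 n r)) ↔ _
  rw [Set.smul_mem_smul_set_iff, Equiv.symm_apply_apply]

theorem smul_mem_smul_fn_iff (p : Γ × Perm V) (S : Interp L V) (F : L.Fn) (x y : V) :
    p • y ∈ (p • S).fn (p.1.1.2 F) (p • x) ↔ y ∈ S.fn F x := by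
  change p • y ∈ p • S.fn (p.1.1.2.symm (p.1.1.2 F)) (p⁻¹ • p • x) ↔ _
  rw [Set.smul_mem_smul_set_iff, Equiv.symm_apply_apply, inv_smul_smul]

theorem finite_orbit_labelledPerm [Finite V] {S : Interp L V}
    (hS : (MulAction.orbit Γ S).Finite) : (MulAction.orbit (Γ × Perm V) S).Finite := by
  refine (Set.Finite.image2 (fun (σ : Perm V) T => ((1, σ) : Γ × Perm V) • T)
    Set.finite_univ hS).subset ?_
  rintro _ ⟨⟨g, σ⟩, rfl⟩
  refine ⟨σ, trivial, g • S, ⟨g, rfl⟩, ?_⟩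
  have relabel : g • S = ((g, 1) : Γ × Perm V) • S :=
    Interp.ext (funext₂ fun n r => (one_smul (Perm V) (_ : Set (Fin n → V))).symm)
      (funext₂ fun F x => (one_smul (Perm V) (_ : Set V)).symm)
  change ((1, σ) : Γ × Perm V) • g • S = ((g, σ) : Γ × Perm V) • S
  rw [relabel, smul_smul, Prod.mk_mul_mk, one_mul, mul_one]

/-- Two interpretations agree on `s`: their relations have the same tuples in `s`, and their
functions have the same values at the vertices in `s`. -/
structure Agree (s : Set V) (S T : Interp L V) : Prop where
  rel : ∀ n (r : L.Rel n) (x : Fin n → V), (∀ i, x i ∈ s) → (x ∈ S.rel n r ↔ x ∈ T.rel n r)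
  fn : ∀ (F : L.Fn), ∀ x ∈ s, S.fn F x = T.fn F x

namespace Agree

variable {s : Set V} {S T U : Interp L V}

theorem refl (s : Set V) (S : Interp L V) : Agree s S S :=
  ⟨fun _ _ _ _ => Iff.rfl, fun _ _ _ => rfl⟩

theorem symm (h : Agree s S T) : Agree s T S :=
  ⟨fun n r x hx => (h.rel n r x hx).symm, fun F x hx => (h.fn F x hx).symm⟩

theorem trans (h : Agree s S T) (h' : Agree s T U) : Agree s S U :=
  ⟨fun n r x hx => (h.rel n r x hx).trans (h'.rel n r x hx),
    fun F x hx => (h.fn F x hx).trans (h'.fn F x hx)⟩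

theorem smul (h : Agree s S T) (p : Γ × Perm V) : Agree (p • s) (p • S) (p • T) := by
  constructor
  · intro n r x hx
    change x ∈ p • S.rel n _ ↔ x ∈ p • T.rel n _
    rw [Set.mem_smul_set_iff_inv_smul_mem, Set.mem_smul_set_iff_inv_smul_mem]
    exact h.rel n _ _ fun i => Set.mem_smul_set_iff_inv_smul_mem.1 (hx i)
  · intro F x hx
    exact congrArg (p • ·) (h.fn _ _ (Set.mem_smul_set_iff_inv_smul_mem.1 hx))

theorem smul_iff (p : Γ × Perm V) : Agree (p • s) (p • S) (p • T) ↔ Agree s S T :=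
  ⟨fun h => by simpa only [inv_smul_smul] using h.smul p⁻¹, fun h => h.smul p⟩

end Agree

/-- `R` is the graph of a partial automorphism of `A` with language part `g`. -/
structure IsPartialAutGraph (A : Struc.{u, v, w} L) (g : Γ) (R : SetRel A.V A.V) : Prop where
  bij : IsPartialBij R
  rel : ∀ n (r : L.Rel n) (x y : Fin n → A.V), (∀ i, (x i, y i) ∈ R) →
    (x ∈ A.str.rel n r ↔ y ∈ A.str.rel n (g.1.1 n r))
  forth : ∀ (F : L.Fn) x y, (x, y) ∈ R →
    ∀ z ∈ A.str.fn F x, ∃ z' ∈ A.str.fn (g.1.2 F) y, (z, z') ∈ R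
  back : ∀ (F : L.Fn) x y, (x, y) ∈ R →
    ∀ z' ∈ A.str.fn (g.1.2 F) y, ∃ z ∈ A.str.fn F x, (z, z') ∈ R

theorem IsPartialAutGraph.agree {A : Struc.{u, v, w} L} {g : Γ} {R : SetRel A.V A.V}
    (hR : IsPartialAutGraph A g R) {σ : Perm A.V} (hσ : ∀ x y, (x, y) ∈ R → σ x = y)
    {s : Set A.V} (hs : s ⊆ R.dom) :
    Agree (((g, σ) : Γ × Perm A.V) • s) (((g, σ) : Γ × Perm A.V) • A.str) A.str := by
  have graph : ∀ x ∈ s, (x, σ x) ∈ R := by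
    intro x hx
    obtain ⟨y, hxy⟩ := hs hx
    rwa [hσ x y hxy]
  constructor
  · intro n r y hy
    obtain ⟨r, rfl⟩ := (g.1.1 n).surjective r
    choose x hx hxy using hy
    obtain rfl : ((g, σ) : Γ × Perm A.V) • x = y := funext hxy
    rw [smul_mem_smul_rel_iff (g, σ)]
    exact hR.rel n r x _ fun i => graph _ (hx i)
  · rintro F _ ⟨x, hx, rfl⟩
    obtain ⟨F, rfl⟩ := g.1.2.surjective F
    ext z
    obtain ⟨z, rfl⟩ := MulAction.surjective ((g, σ) : Γ × Perm A.V) z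
    rw [smul_mem_smul_fn_iff (g, σ)]
    constructor
    · intro hz
      obtain ⟨z', hz', hzz'⟩ := hR.forth F x _ (graph x hx) z hz
      rwa [← hσ z z' hzz'] at hz'
    · intro hz
      obtain ⟨z', hz', hzz'⟩ := hR.back F x _ (graph x hx) _ hz
      rwa [← σ.injective (hσ z' _ hzz')]

/-- The permutation `σ` describes the partial automorphism of `A` which `h` induces on the set of
those vertices of `A` (placed in `V` by `ι`) which `h` does not move out of `A`. -/
structure Induces (A : Struc.{u, v, w} L) (ι : A.V → V) (h : Γ × Perm V) (σ : Perm A.V) :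
    Prop where
  apply_eq : ∀ a b, h • ι a = ι b → σ a = b
  rel : ∀ n (r : L.Rel n) (x : Fin n → A.V), (∀ i, h • ι (x i) ∈ Set.range ι) →
    (x ∈ A.str.rel n r ↔ σ ∘ x ∈ A.str.rel n (h.1.1.1 n r))
  fn : ∀ (F : L.Fn) x, h • ι x ∈ Set.range ι →
    ∀ z, z ∈ A.str.fn F x ↔ σ z ∈ A.str.fn (h.1.1.2 F) (σ x)

theorem Induces.of_agree {A : Struc.{u, v, w} L} {ι : A.V → V} {h : Γ × Perm V} {σ : Perm A.V}
    (apply_eq : ∀ a b, h • ι a = ι b → σ a = b)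
    (agree : ∀ s : Finset A.V, s.Nonempty → (∀ a ∈ s, h • ι a ∈ Set.range ι) →
      Agree (((h.1, σ) : Γ × Perm A.V) • (s : Set A.V)) (((h.1, σ) : Γ × Perm A.V) • A.str)
        A.str) :
    Induces A ι h σ where
  apply_eq := apply_eq
  rel n r x hx := by
    classical
    have : Nonempty (Fin n) := by
      rcases n with _ | n
      · exact L.rel_zero.elim r
      · infer_instance
    have on_image := agree (Finset.univ.image x) (Finset.univ_nonempty.image x) (by simpa using hx)
    rw [← smul_mem_smul_rel_iff (h.1, σ)]
    exact on_image.rel n _ _ fun i => Set.smul_mem_smul_set (by simp)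
  fn F x hx z := by
    have at_point := agree {x} (Finset.singleton_nonempty x) (by simpa using hx)
    rw [← smul_mem_smul_fn_iff (h.1, σ),
      at_point.fn _ _ (Set.smul_mem_smul_set (by simp))]
    rfl

theorem exists_inducing_cover (A : Struc.{u, v, w} L) [Finite A.V]
    (hA : (MulAction.orbit Γ A.str).Finite) :
    ∃ (V : Type w) (_ : Finite V) (H : Subgroup (Γ × Perm V)) (ι : A.V → V),
      Function.Injective ι ∧ HasCoherentExtension H ι (IsPartialAutGraph (Γ := Γ) A) ∧
      ∀ h ∈ H, ∃ σ, Induces A ι h σ := by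
  classical
  let O := MulAction.orbit (Γ × Perm A.V) A.str
  have : Finite O := finite_orbit_labelledPerm hA
  -- The index type of the parity cover enters the universe of its vertices.
  let e := Finite.equivFin (Finset A.V × O)
  let _ : MulAction (Γ × Perm A.V) (Fin (Nat.card (Finset A.V × O))) :=
    e.symm.mulAction (Γ × Perm A.V)
  have e_symm_smul (p : Γ × Perm A.V) j : e.symm (p • j) = p • e.symm j :=
    e.symm_apply_apply _
  obtain ⟨V, hV, H, ι, hι, hExt, hH⟩ := exists_parity_cover
    (fun j => (e.symm j).1)
    (fun p j => by rw [e_symm_smul, Finset.map_eq_image]; rfl)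
    (fun j => Agree (e.symm j).1 (e.symm j).2.1 A.str) (IsPartialAutGraph A) (fun g R h => h.bij)
    (fun g R hR σ hσ j hj => by
      have fixes := hR.agree hσ hj
      rw [e_symm_smul, Prod.smul_fst, Prod.smul_snd, Finset.coe_smul_finset,
        MulAction.orbit.coe_smul]
      exact ⟨fun h => (Agree.smul_iff _).1 (h.trans fixes.symm), fun h => (h.smul _).trans fixes⟩)
  refine ⟨V, hV, H, ι, hι, hExt, fun h hh => ?_⟩
  obtain ⟨σ, hσ, hgood⟩ := hH h hh
  refine ⟨σ, .of_agree hσ fun s hs hsι => ?_⟩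
  have good_iff := hgood (e (s, ⟨A.str, MulAction.mem_orbit_self _⟩))
  rw [e_symm_smul, Equiv.symm_apply_apply] at good_iff
  have agree_smul := (good_iff hs hsι).2 (.refl _ _)
  rwa [Prod.smul_fst, Prod.smul_snd, Finset.coe_smul_finset, MulAction.orbit.coe_smul]
    at agree_smul

theorem Induces.of_projection {A : Struc.{u, v, w} L} {V' : Type w} {ι : A.V → V}
    {ι' : A.V → V'} {π : V' → V} (hπι : ∀ a, π (ι' a) = ι a) {h : Γ × Perm V}
    {h' : Γ × Perm V'} (lang_eq : h'.1 = h.1) (hπ : ∀ u, π (h' • u) = h • π u) {σ : Perm A.V}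
    (hσ : Induces A ι h σ) : Induces A ι' h' σ := by
  have project {a b : A.V} (hab : h' • ι' a = ι' b) : h • ι a = ι b := by
    rw [← hπι, ← hπι, ← hπ, hab]
  have project_range {a : A.V} : h' • ι' a ∈ Set.range ι' → h • ι a ∈ Set.range ι :=
    fun ⟨b, hb⟩ => ⟨b, (project hb.symm).symm⟩
  refine ⟨fun a b hab => hσ.apply_eq a b (project hab), fun n r x hx => ?_, fun F x hx z => ?_⟩
  · rw [lang_eq]
    exact hσ.rel n r x fun i => project_range (hx i)
  · rw [lang_eq]
    exact hσ.fn F x (project_range hx) z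

theorem exists_conformal_inducing_cover (A : Struc.{u, v, w} L) [Finite A.V]
    (hA : (MulAction.orbit Γ A.str).Finite) :
    ∃ (V : Type w) (_ : Finite V) (H : Subgroup (Γ × Perm V)) (ι : A.V → V),
      Function.Injective ι ∧ HasCoherentExtension H ι (IsPartialAutGraph (Γ := Γ) A) ∧
      (∀ h ∈ H, ∃ σ, Induces A ι h σ) ∧ IsConformal H ι := by
  obtain ⟨V, hV, H, ι, hι, hExt, hH⟩ := exists_inducing_cover A hA
  obtain ⟨H', ι', hExt', hπι, hπ, hconf⟩ :=
    exists_conformal_cover hι (IsPartialAutGraph A) (fun _ _ h => h.bij) hExt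
  refine ⟨Coloured V, inferInstance, H', ι', ?_, hExt', fun h hh => ?_, hconf⟩
  · refine .of_comp (f := Prod.fst) ?_
    rwa [show Prod.fst ∘ ι' = ι from funext hπι]
  · obtain ⟨τ, hτ, hπτ⟩ := hπ h hh
    obtain ⟨σ, hσ⟩ := hH _ hτ
    exact ⟨σ, hσ.of_projection hπι rfl hπτ⟩

end Relabelling

/-! ### The cover structure -/

section CoverStructure

variable {L : UnaryLanguage.{u, v}} {Γ : Subgroup L.Perm} {A : Struc.{u, v, w} L} {V : Type w}
  {H : Subgroup (Γ × Perm V)} {ι : A.V → V}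

theorem Embedding.ext {B : Struc.{u, v, w} L} {f g : Embedding Γ A B} (lang : f.lang = g.lang)
    (toFun : ∀ x, f.toFun x = g.toFun x) : f = g := by
  cases f
  cases g
  obtain rfl : _ = _ := lang
  obtain rfl : _ = _ := funext toFun
  rfl

/-- The substructure of `A` generated by the vertex `a`. -/
def Struc.closure (A : Struc.{u, v, w} L) (a : A.V) : Substruc A where
  verts := {b | ∀ S : Substruc A, a ∈ S.verts → b ∈ S.verts}
  closed F x hx _ hy S ha := S.closed F x (hx S ha) hy

theorem Struc.mem_closure_self (a : A.V) : a ∈ (A.closure a).verts :=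
  fun _ ha => ha

theorem Struc.closure_subset {S : Substruc A} {a : A.V} (ha : a ∈ S.verts) :
    (A.closure a).verts ⊆ S.verts :=
  fun _ hb => hb S ha

namespace Induces

variable {h : Γ × Perm V} {σ : Perm A.V} {a : A.V}

theorem smul_eq (hσ : Induces A ι h σ) (ha : h • ι a ∈ Set.range ι) : h • ι a = ι (σ a) := by
  obtain ⟨b, hb⟩ := ha
  rw [← hb, hσ.apply_eq a b hb.symm]

theorem image_closure (hσ : Induces A ι h σ)
    (ha : ∀ c ∈ (A.closure a).verts, h • ι c ∈ Set.range ι) :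
    σ '' (A.closure a).verts = (A.closure (σ a)).verts := by
  let imageClosure : Substruc A :=
    { verts := σ '' (A.closure a).verts
      closed := by
        rintro F _ ⟨c, hc, rfl⟩ d hd
        refine ⟨σ.symm d, (A.closure a).closed (h.1.1.2.symm F) c hc ?_, σ.apply_symm_apply d⟩
        rwa [hσ.fn _ c (ha c hc), Equiv.apply_symm_apply, Equiv.apply_symm_apply] }
  let preimageClosure : Substruc A :=
    { verts := (A.closure a).verts ∩ σ ⁻¹' (A.closure (σ a)).verts
      closed := fun F c hc d hd => ⟨(A.closure a).closed F c hc.1 hd,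
        (A.closure (σ a)).closed _ _ hc.2 ((hσ.fn F c (ha c hc.1) d).1 hd)⟩ }
  apply Set.Subset.antisymm
  · rintro _ ⟨c, hc, rfl⟩
    exact (Struc.closure_subset (S := preimageClosure)
      ⟨Struc.mem_closure_self a, Struc.mem_closure_self (σ a)⟩ hc).2
  · exact Struc.closure_subset (S := imageClosure) ⟨a, Struc.mem_closure_self a, rfl⟩

end Induces

/-- A vertex of `A` together with its closure, placed in `V` by `ι`. Recording the closure makes
the functions of the cover structure well behaved: translates of `A` which share a vertex with
its closure also share the values of the functions there. -/
def withClosure (ι : A.V → V) (a : A.V) : V × Set V :=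
  (ι a, ι '' (A.closure a).verts)

theorem Induces.smul_withClosure {h : Γ × Perm V} {σ : Perm A.V} {a : A.V}
    (hσ : Induces A ι h σ) (ha : ∀ c ∈ (A.closure a).verts, h • ι c ∈ Set.range ι) :
    h • withClosure ι a = withClosure ι (σ a) := by
  refine Prod.ext (hσ.smul_eq (ha a (Struc.mem_closure_self a))) ?_
  change (h • ·) '' (ι '' (A.closure a).verts) = ι '' (A.closure (σ a)).verts
  rw [← hσ.image_closure ha, Set.image_image, Set.image_image]
  exact Set.image_congr fun c hc => hσ.smul_eq (ha c hc)

/-- The vertices of the cover structure: the translates under `H` of the vertices of `A` with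
their closures. -/
def coverVertices (H : Subgroup (Γ × Perm V)) (ι : A.V → V) : SubMulAction H (V × Set V) where
  carrier := {p | ∃ (h : H) (a : A.V), p = h • withClosure ι a}
  smul_mem' := by
    rintro k _ ⟨h, a, rfl⟩
    exact ⟨k * h, a, (mul_smul k h _).symm⟩

/-- The vertex of the cover structure given by a vertex of `A`. -/
def baseVertex (H : Subgroup (Γ × Perm V)) (ι : A.V → V) (a : A.V) : coverVertices H ι :=
  ⟨withClosure ι a, 1, a, (one_smul H _).symm⟩

theorem exists_eq_smul_baseVertex (p : coverVertices H ι) :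
    ∃ (h : H) (a : A.V), p = h • baseVertex H ι a := by
  obtain ⟨h, a, ha⟩ := p.2
  exact ⟨h, a, Subtype.ext ha⟩

theorem Induces.smul_baseVertex {h : H} {σ : Perm A.V} {a : A.V} (hσ : Induces A ι h.1 σ)
    (ha : ∀ c ∈ (A.closure a).verts, h.1 • ι c ∈ Set.range ι) :
    h • baseVertex H ι a = baseVertex H ι (σ a) :=
  Subtype.ext (hσ.smul_withClosure ha)

theorem smul_mem_range_of_smul_baseVertex_eq {h : H} {a b : A.V}
    (hab : h • baseVertex H ι a = baseVertex H ι b) :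
    ∀ c ∈ (A.closure a).verts, h.1 • ι c ∈ Set.range ι := by
  intro c hc
  have closure_eq : h.1 • (ι '' (A.closure a).verts) = ι '' (A.closure b).verts :=
    congrArg (fun p => p.1.2) hab
  refine Set.image_subset_range ι (A.closure b).verts ?_
  rw [← closure_eq]
  exact Set.smul_mem_smul_set (Set.mem_image_of_mem ι hc)

/-- The structure on the cover whose relations and functions are the translates under `H` of
those of `A`. -/
abbrev coverStruc (A : Struc.{u, v, w} L) (H : Subgroup (Γ × Perm V)) (ι : A.V → V) :
    Struc.{u, v, w} L where
  V := coverVertices H ι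
  str :=
    { rel := fun n r => {x | ∃ (h : H) (s : L.Rel n) (y : Fin n → A.V), h.1.1.1.1 n s = r ∧
        y ∈ A.str.rel n s ∧ ∀ i, x i = h • baseVertex H ι (y i)}
      fn := fun F p => {q | ∃ (h : H) (F' : L.Fn) (a b : A.V), h.1.1.1.2 F' = F ∧
        b ∈ A.str.fn F' a ∧ p = h • baseVertex H ι a ∧ q = h • baseVertex H ι b} }

theorem smul_mem_coverStruc_rel (h : H) {n} {r : L.Rel n} {x : Fin n → coverVertices H ι}
    (hx : x ∈ (coverStruc A H ι).str.rel n r) :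
    h • x ∈ (coverStruc A H ι).str.rel n (h.1.1.1.1 n r) := by
  obtain ⟨k, s, y, rfl, hy, hxy⟩ := hx
  exact ⟨h * k, s, y, rfl, hy, fun i => by rw [Pi.smul_apply, hxy, mul_smul]⟩

theorem smul_mem_coverStruc_fn (h : H) {F : L.Fn} {p q : coverVertices H ι}
    (hq : q ∈ (coverStruc A H ι).str.fn F p) :
    h • q ∈ (coverStruc A H ι).str.fn (h.1.1.1.2 F) (h • p) := by
  obtain ⟨k, F', a, b, rfl, hb, rfl, rfl⟩ := hq
  exact ⟨h * k, F', a, b, rfl, hb, (mul_smul _ _ _).symm, (mul_smul _ _ _).symm⟩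

/-- The automorphism of the cover structure induced by an element of `H`. -/
def coverAut (ι : A.V → V) (h : H) : Iso Γ (coverStruc A H ι) (coverStruc A H ι) where
  lang := h.1.1
  toFun p := h • p
  injective := MulAction.injective h
  surjective := MulAction.surjective h
  map_rel n r x := by
    refine ⟨smul_mem_coverStruc_rel h, fun hx => ?_⟩
    have back := smul_mem_coverStruc_rel h⁻¹ hx
    change h⁻¹ • h • x ∈ (coverStruc A H ι).str.rel n ((h.1.1.1.1 n).symm (h.1.1.1.1 n r)) at back
    rwa [inv_smul_smul, Equiv.symm_apply_apply] at back
  map_fn F p := by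
    apply Set.Subset.antisymm
    · rintro _ ⟨q, hq, rfl⟩
      exact smul_mem_coverStruc_fn h hq
    · intro q hq
      refine ⟨h⁻¹ • q, ?_, smul_inv_smul h q⟩
      have back := smul_mem_coverStruc_fn h⁻¹ hq
      change _ ∈ (coverStruc A H ι).str.fn (h.1.1.1.2.symm (h.1.1.1.2 F)) (h⁻¹ • h • p) at back
      rwa [inv_smul_smul, Equiv.symm_apply_apply] at back

theorem coverAut_mul (h k : H) :
    (coverAut ι (h * k)).toEmbedding =
      (coverAut ι h).toEmbedding.comp (coverAut ι k).toEmbedding :=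
  Embedding.ext rfl (mul_smul h k)

theorem mem_rel_iff_baseVertex_mem_rel (hH : ∀ h ∈ H, ∃ σ, Induces A ι h σ) {n} (r : L.Rel n)
    (x : Fin n → A.V) :
    x ∈ A.str.rel n r ↔ baseVertex H ι ∘ x ∈ (coverStruc A H ι).str.rel n r := by
  refine ⟨fun hx => ⟨1, r, x, rfl, hx, fun i => (one_smul H _).symm⟩, ?_⟩
  rintro ⟨h, s, y, rfl, hy, hxy⟩
  obtain ⟨σ, hσ⟩ := hH h.1 h.2
  have smul_y i : h.1 • ι (y i) = ι (x i) := (congrArg (fun p => p.1.1) (hxy i)).symm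
  obtain rfl : σ ∘ y = x := funext fun i => hσ.apply_eq _ _ (smul_y i)
  exact (hσ.rel n s y fun i => ⟨_, (smul_y i).symm⟩).1 hy

theorem image_baseVertex_fn (hH : ∀ h ∈ H, ∃ σ, Induces A ι h σ) (F : L.Fn) (x : A.V) :
    baseVertex H ι '' A.str.fn F x = (coverStruc A H ι).str.fn F (baseVertex H ι x) := by
  apply Set.Subset.antisymm
  · rintro _ ⟨b, hb, rfl⟩
    exact ⟨1, F, x, b, rfl, hb, (one_smul H _).symm, (one_smul H _).symm⟩
  · rintro _ ⟨h, F', a, b, rfl, hb, hx, rfl⟩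
    obtain ⟨σ, hσ⟩ := hH h.1 h.2
    have closure_a := smul_mem_range_of_smul_baseVertex_eq hx.symm
    have closure_b : (A.closure b).verts ⊆ (A.closure a).verts :=
      Struc.closure_subset ((A.closure a).closed F' a (Struc.mem_closure_self a) hb)
    obtain rfl : σ a = x := hσ.apply_eq a x (congrArg (fun p => p.1.1) hx).symm
    exact ⟨σ b, (hσ.fn F' a (closure_a a (Struc.mem_closure_self a)) b).1 hb,
      (hσ.smul_baseVertex fun c hc => closure_a c (closure_b hc)).symm⟩

/-- The embedding of `A` into the cover structure. -/
def coverEmbedding (hι : Function.Injective ι) (hH : ∀ h ∈ H, ∃ σ, Induces A ι h σ) :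
    Embedding Γ A (coverStruc A H ι) where
  lang := 1
  toFun := baseVertex H ι
  injective _ _ hab := hι (congrArg (fun p => p.1.1) hab)
  map_rel _ := mem_rel_iff_baseVertex_mem_rel hH
  map_fn := image_baseVertex_fn hH

end CoverStructure

section Graph

variable {L : UnaryLanguage.{u, v}} {Γ : Subgroup L.Perm} {A B : Struc.{u, v, w} L}

namespace PartialAut

theorem app_injective (p : PartialAut Γ B) : Function.Injective p.app :=
  Subtype.val_injective.comp p.iso.injective

theorem app_mem_cod (p : PartialAut Γ B) (x : p.dom.verts) : p.app x ∈ p.cod.verts :=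
  (p.iso.toFun x).2

theorem image_app_fn (p : PartialAut Γ B) (F : L.Fn) (x : p.dom.verts) :
    p.app '' {y | (y : B.V) ∈ B.str.fn F x} = B.str.fn (p.iso.lang.1.2 F) (p.app x) := by
  have on_cod := p.iso.map_fn F x
  ext z
  constructor
  · rintro ⟨y, hy, rfl⟩
    exact (Set.ext_iff.1 on_cod (p.iso.toFun y)).1 ⟨y, hy, rfl⟩
  · intro hz
    obtain ⟨y, hy, hyz⟩ :=
      (Set.ext_iff.1 on_cod ⟨z, p.cod.closed _ _ (p.app_mem_cod x) hz⟩).2 hz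
    exact ⟨y, hy, congrArg Subtype.val hyz⟩

/-- The graph of a partial automorphism, pulled back along an embedding `ψ`. -/
def graph (p : PartialAut Γ B) (ψ : Embedding Γ A B) : SetRel A.V A.V :=
  {q | ∃ h : ψ.toFun q.1 ∈ p.dom.verts, p.app ⟨ψ.toFun q.1, h⟩ = ψ.toFun q.2}

variable {p : PartialAut Γ B} {ψ : Embedding Γ A B}

theorem isPartialBij_graph (p : PartialAut Γ B) (ψ : Embedding Γ A B) :
    IsPartialBij (p.graph ψ) := by
  rintro a b a' b' ⟨ha, hab⟩ ⟨ha', hab'⟩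
  constructor
  · rintro rfl
    exact ψ.injective (hab.symm.trans hab')
  · rintro rfl
    exact ψ.injective (congrArg Subtype.val (p.app_injective (hab.trans hab'.symm)))

theorem isPartialAutGraph (hψ : ψ.lang = 1) : IsPartialAutGraph A p.iso.lang (p.graph ψ) := by
  have ψ_rel n (r : L.Rel n) x : x ∈ A.str.rel n r ↔ ψ.toFun ∘ x ∈ B.str.rel n r := by
    have := ψ.map_rel n r x
    rwa [hψ] at this
  have ψ_fn (F : L.Fn) x : ψ.toFun '' A.str.fn F x = B.str.fn F (ψ.toFun x) := by
    have := ψ.map_fn F x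
    rwa [hψ] at this
  refine ⟨p.isPartialBij_graph ψ, ?_, ?_, ?_⟩
  · intro n r x y hxy
    choose hx hxy using hxy
    rw [ψ_rel, ψ_rel, show ψ.toFun ∘ y = _ from (funext hxy).symm]
    exact p.iso.map_rel n r fun i => ⟨ψ.toFun (x i), hx i⟩
  · rintro F x y ⟨hx, hxy⟩ z hz
    have ψz_mem : ψ.toFun z ∈ B.str.fn F (ψ.toFun x) := ψ_fn F x ▸ ⟨z, hz, rfl⟩
    have ψz_dom : ψ.toFun z ∈ p.dom.verts := p.dom.closed _ _ hx ψz_mem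
    have app_mem : p.app ⟨_, ψz_dom⟩ ∈ B.str.fn (p.iso.lang.1.2 F) (p.app ⟨_, hx⟩) :=
      p.image_app_fn F ⟨_, hx⟩ ▸ ⟨_, ψz_mem, rfl⟩
    rw [hxy, ← ψ_fn] at app_mem
    obtain ⟨z', hz', app_eq⟩ := app_mem
    exact ⟨z', hz', ψz_dom, app_eq.symm⟩
  · rintro F x y ⟨hx, hxy⟩ z' hz'
    have ψz'_mem : ψ.toFun z' ∈ B.str.fn (p.iso.lang.1.2 F) (p.app ⟨_, hx⟩) := by
      rw [hxy, ← ψ_fn]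
      exact ⟨z', hz', rfl⟩
    rw [← p.image_app_fn] at ψz'_mem
    obtain ⟨⟨w, w_dom⟩, hw, app_eq⟩ := ψz'_mem
    obtain ⟨z, hz, rfl⟩ : w ∈ ψ.toFun '' A.str.fn F x := ψ_fn F x ▸ hw
    exact ⟨z, hz, w_dom, app_eq⟩

theorem exists_mem_graph (hp : p.IsOn ψ.range) {a : A.V} (ha : ψ.toFun a ∈ p.dom.verts) :
    ∃ b, (a, b) ∈ p.graph ψ := by
  obtain ⟨b, hb⟩ := hp.2 (p.app_mem_cod ⟨_, ha⟩)
  exact ⟨b, ha, hb.symm⟩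

end PartialAut

namespace CoherentTriple

variable {f g h : PartialAut Γ B} {ψ : Embedding Γ A B}

theorem cod_graph_eq_dom_graph (hfgh : CoherentTriple f g h) (hf : f.IsOn ψ.range)
    (hg : g.IsOn ψ.range) : (f.graph ψ).cod = (g.graph ψ).dom := by
  obtain ⟨-, cod_eq_dom, -⟩ := hfgh
  ext b
  constructor
  · rintro ⟨a, ha, hab⟩
    refine PartialAut.exists_mem_graph hg ?_
    rw [← cod_eq_dom, ← hab]
    exact f.app_mem_cod _
  · rintro ⟨c, hb, -⟩
    rw [← cod_eq_dom] at hb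
    obtain ⟨⟨x, hx⟩, hxb⟩ := f.iso.surjective ⟨_, hb⟩
    obtain ⟨a, rfl⟩ := hf.1 hx
    exact ⟨a, hx, congrArg Subtype.val hxb⟩

theorem graph_eq_comp (hfgh : CoherentTriple f g h) (hf : f.IsOn ψ.range) :
    h.graph ψ = f.graph ψ ○ g.graph ψ := by
  obtain ⟨dom_eq, cod_eq_dom, -, -, app_eq⟩ := hfgh
  ext ⟨a, c⟩
  constructor
  · rintro ⟨ha, hac⟩
    have ha_f : ψ.toFun a ∈ f.dom.verts := dom_eq ▸ ha
    obtain ⟨b, hb, hab⟩ := PartialAut.exists_mem_graph hf ha_f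
    have hb_g : ψ.toFun b ∈ g.dom.verts := by
      rw [← cod_eq_dom, ← hab]
      exact f.app_mem_cod _
    exact ⟨b, ⟨hb, hab⟩, hb_g,
      (app_eq ⟨_, ha_f⟩ ⟨_, hb_g⟩ ⟨_, ha⟩ rfl hab.symm).symm.trans hac⟩
  · rintro ⟨b, ⟨ha, hab⟩, hb, hbc⟩
    have ha_h : ψ.toFun a ∈ h.dom.verts := dom_eq ▸ ha
    exact ⟨ha_h, (app_eq ⟨_, ha⟩ ⟨_, hb⟩ ⟨_, ha_h⟩ rfl hab.symm).trans hbc⟩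

end CoherentTriple

end Graph

/-! ### Free covers -/

section FreeAmalgamation

variable {L : UnaryLanguage.{u, v}} {Γ : Subgroup L.Perm} {A B C : Struc.{u, v, w} L}

/-- The identity embedding. -/
def Embedding.refl (Γ : Subgroup L.Perm) (A : Struc.{u, v, w} L) : Embedding Γ A A where
  lang := 1
  toFun := id
  injective := Function.injective_id
  map_rel _ _ _ := Iff.rfl
  map_fn _ _ := Set.image_id _

theorem Embedding.nonempty_of_range_subset {f : Embedding Γ A C} {g : Embedding Γ B C}
    (hfg : Set.range f.toFun ⊆ Set.range g.toFun) : Nonempty (Embedding Γ A B) := by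
  choose m hm using fun a => hfg (Set.mem_range_self a)
  have comp_m : g.toFun ∘ m = f.toFun := funext hm
  refine ⟨⟨g.lang⁻¹ * f.lang, m, ?_, fun n r x => ?_, fun F x => ?_⟩⟩
  · exact .of_comp (comp_m ▸ f.injective)
  · have lang_apply : g.lang.1.1 n ((g.lang⁻¹ * f.lang).1.1 n r) = f.lang.1.1 n r :=
      Equiv.apply_symm_apply (g.lang.1.1 n) _
    rw [f.map_rel, g.map_rel, lang_apply, ← comp_m]
    rfl
  · apply g.injective.image_injective
    rw [← Set.image_comp, comp_m, f.map_fn, g.map_fn, hm]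
    exact congrArg (C.str.fn · _) (Equiv.apply_symm_apply g.lang.1.2 _).symm

namespace Substruc

/-- The preimage of a substructure under an embedding. -/
def comap (f : Embedding Γ A B) (S : Substruc B) : Substruc A where
  verts := f.toFun ⁻¹' S.verts
  closed F x hx _ hy :=
    S.closed (f.lang.1.2 F) (f.toFun x) hx (f.map_fn F x ▸ Set.mem_image_of_mem f.toFun hy)

/-- The image of a substructure under an embedding. -/
def map (f : Embedding Γ A B) (S : Substruc A) : Substruc B :=
  (f.comp (S.subtype Γ)).range

theorem nonempty_embedding_map (f : Embedding Γ A B) (S : Substruc A) :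
    Nonempty (Embedding Γ S.toStruc (S.map f).toStruc) :=
  Embedding.nonempty_of_range_subset (f := f.comp (S.subtype Γ)) (g := (S.map f).subtype Γ)
    fun x hx => ⟨⟨x, hx⟩, rfl⟩

/-- The inclusion of `S ∩ T` into `S`. -/
abbrev interLeft (Γ : Subgroup L.Perm) (S T : Substruc B) :
    Embedding Γ (S.inter T).toStruc S.toStruc :=
  inclusion Γ Set.inter_subset_left

/-- The inclusion of `S ∩ T` into `T`. -/
abbrev interRight (Γ : Subgroup L.Perm) (S T : Substruc B) :
    Embedding Γ (S.inter T).toStruc T.toStruc :=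
  inclusion Γ Set.inter_subset_right

/-- The structure `B` is the union of `S` and `T`, without relations between `S \ T` and
`T \ S`. -/
structure IsFreeCover (S T : Substruc B) : Prop where
  mem_or_mem : ∀ x, x ∈ S.verts ∨ x ∈ T.verts
  rel : ∀ n (r : L.Rel n) (x : Fin n → B.V), x ∈ B.str.rel n r →
    (∀ i, x i ∈ S.verts) ∨ ∀ i, x i ∈ T.verts

variable {S T : Substruc B}

theorem mem_range_interLeft {x : S.verts} :
    x ∈ Set.range (interLeft Γ S T).toFun ↔ x.1 ∈ T.verts :=
  ⟨fun ⟨y, hy⟩ => hy ▸ y.2.2, fun hx => ⟨⟨x.1, x.2, hx⟩, rfl⟩⟩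

theorem mem_range_interRight {x : T.verts} :
    x ∈ Set.range (interRight Γ S T).toFun ↔ x.1 ∈ S.verts :=
  ⟨fun ⟨y, hy⟩ => hy ▸ y.2.1, fun hx => ⟨⟨x.1, hx, x.2⟩, rfl⟩⟩

theorem isFreeAmalgamation_subtype_iff :
    IsFreeAmalgamation (interLeft Γ S T) (interRight Γ S T) (S.subtype Γ) (T.subtype Γ) ↔
      IsFreeCover S T := by
  constructor
  · rintro ⟨-, union_eq, no_rel⟩
    have cover x : x ∈ S.verts ∨ x ∈ T.verts := by
      rcases Set.eq_univ_iff_forall.1 union_eq x with ⟨y, rfl⟩ | ⟨y, rfl⟩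
      · exact .inl y.2
      · exact .inr y.2
    refine ⟨cover, fun n r x hx => ?_⟩
    by_contra! hST
    obtain ⟨⟨i, hi⟩, j, hj⟩ := hST
    have hiT := (cover (x i)).resolve_left hi
    have hjS := (cover (x j)).resolve_right hj
    exact no_rel n r x ⟨j, ⟨x j, hjS⟩, mem_range_interLeft.not.2 hj, rfl⟩
      ⟨i, ⟨x i, hiT⟩, mem_range_interRight.not.2 hi, rfl⟩ hx
  · intro h
    refine ⟨⟨rfl, fun x y => ⟨fun hxy => ?_, ?_⟩⟩, Set.eq_univ_iff_forall.2 fun x => ?_, ?_⟩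
    · have x_eq_y : x.1 = y.1 := hxy
      exact ⟨⟨x.1, x.2, x_eq_y ▸ y.2⟩, rfl, Subtype.ext x_eq_y⟩
    · rintro ⟨a, rfl, rfl⟩
      rfl
    · exact (h.mem_or_mem x).imp (fun hx => ⟨⟨x, hx⟩, rfl⟩) fun hx => ⟨⟨x, hx⟩, rfl⟩
    · rintro n r x ⟨i, a, ha, hai⟩ ⟨j, b, hb, hbj⟩ hx
      rcases h.rel n r x hx with hS | hT
      · exact hb (mem_range_interRight.2 ((show b.1 = x j from hbj) ▸ hS j))
      · exact ha (mem_range_interLeft.2 ((show a.1 = x i from hai) ▸ hT i))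

end Substruc

theorem Irreducible.exists_mem_mem {κ : Type*} (hB : Irreducible Γ B) (D : κ → Substruc B)
    (cover : ∀ x, ∃ k, x ∈ (D k).verts)
    (rel : ∀ n (r : L.Rel n) (t : Fin n → B.V), t ∈ B.str.rel n r →
      ∃ k, ∀ i, t i ∈ (D k).verts) (x y : B.V) :
    ∃ k, x ∈ (D k).verts ∧ y ∈ (D k).verts := by
  let union (P : κ → Prop) : Substruc B :=
    { verts := {z | ∃ k, P k ∧ z ∈ (D k).verts}
      closed := fun F z ⟨k, hk, hz⟩ _ hw => ⟨k, hk, (D k).closed F z hz hw⟩ }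
  by_contra! hxy
  refine hB ⟨union fun k => x ∉ (D k).verts, union fun k => x ∈ (D k).verts, ?_, ?_,
    Substruc.isFreeAmalgamation_subtype_iff.2 ⟨fun z => ?_, fun n r t ht => ?_⟩⟩
  · intro h
    obtain ⟨k, hk, hx⟩ := Set.eq_univ_iff_forall.1 h x
    exact hk hx
  · intro h
    obtain ⟨k, hx, hy⟩ := Set.eq_univ_iff_forall.1 h y
    exact hxy k hx hy
  · obtain ⟨k, hz⟩ := cover z
    exact (Classical.em (x ∈ (D k).verts)).symm.imp (fun hk => ⟨k, hk, hz⟩) fun hk => ⟨k, hk, hz⟩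
  · obtain ⟨k, hk⟩ := rel n r t ht
    exact (Classical.em (x ∈ (D k).verts)).symm.imp (fun h i => ⟨k, h, hk i⟩)
      fun h i => ⟨k, h, hk i⟩

end FreeAmalgamation

section EPPA

variable {L : UnaryLanguage.{u, v}} {Γ : Subgroup L.Perm} {A : Struc.{u, v, w} L} {V : Type w}
  {H : Subgroup (Γ × Perm V)} {ι : A.V → V}

theorem IsPartialAutGraph.closure_subset_dom {g : Γ} {R : SetRel A.V A.V}
    (hR : IsPartialAutGraph A g R) {a : A.V} (ha : a ∈ R.dom) : (A.closure a).verts ⊆ R.dom := by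
  let domain : Substruc A :=
    { verts := R.dom
      closed := by
        rintro F x ⟨y, hxy⟩ z hz
        obtain ⟨z', -, hzz'⟩ := hR.forth F x y hxy z hz
        exact ⟨z', hzz'⟩ }
  exact Struc.closure_subset (S := domain) ha

theorem IsPartialAutGraph.smul_baseVertex (hH : ∀ h ∈ H, ∃ σ, Induces A ι h σ) {g : Γ}
    {R : SetRel A.V A.V} (hR : IsPartialAutGraph A g R) {h : H}
    (hh : ∀ x y, (x, y) ∈ R → h.1 • ι x = ι y) {a b : A.V} (hab : (a, b) ∈ R) :
    h • baseVertex H ι a = baseVertex H ι b := by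
  obtain ⟨σ, hσ⟩ := hH h.1 h.2
  rw [← hσ.apply_eq a b (hh a b hab)]
  refine hσ.smul_baseVertex fun c hc => ?_
  obtain ⟨d, hcd⟩ := hR.closure_subset_dom ⟨b, hab⟩ hc
  exact ⟨d, (hh c d hcd).symm⟩

theorem isCoherentEPPAEmbedding_coverEmbedding (hι : Function.Injective ι)
    (hH : ∀ h ∈ H, ∃ σ, Induces A ι h σ)
    (hExt : HasCoherentExtension H ι (IsPartialAutGraph (Γ := Γ) A)) :
    IsCoherentEPPAEmbedding (coverEmbedding hι hH) := by
  obtain ⟨E, hE, hE_mul⟩ := hExt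
  let ψ := coverEmbedding hι hH
  have graph (p : PartialAut Γ (coverStruc A H ι)) :
      IsPartialAutGraph A p.iso.lang (p.graph ψ) :=
    PartialAut.isPartialAutGraph rfl
  let lift (p : PartialAut Γ (coverStruc A H ι)) : H := ⟨_, (hE _ _ (graph p)).1⟩
  refine ⟨fun p => coverAut ι (lift p.1), fun p => ⟨rfl, ?_⟩, fun f g h hfgh => ?_⟩
  · rintro ⟨x, hx⟩
    obtain ⟨a, rfl⟩ := p.2.1 hx
    obtain ⟨b, hab⟩ := PartialAut.exists_mem_graph p.2 hx
    exact ((graph p.1).smul_baseVertex hH (h := lift p.1) (hE _ _ (graph p.1)).2 hab).trans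
      hab.2.symm
  · have lift_mul : lift h.1 = lift g.1 * lift f.1 := by
      refine Subtype.ext (Prod.ext hfgh.2.2.2.1 ?_)
      change E h.1.iso.lang (h.1.graph ψ) = _
      rw [hfgh.graph_eq_comp f.2, hfgh.2.2.2.1]
      exact hE_mul _ _ _ _ (graph f.1) (graph g.1) (hfgh.cod_graph_eq_dom_graph f.2 g.2)
    exact (congrArg (fun k => (coverAut ι k).toEmbedding) lift_mul).trans (coverAut_mul _ _)

theorem isTranslatable_of_irreducible (hι : Function.Injective ι)
    (hH : ∀ h ∈ H, ∃ σ, Induces A ι h σ) (hconf : IsConformal H ι)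
    {D : Substruc (coverStruc A H ι)} (hD : Irreducible Γ D.toStruc) :
    IsTranslatable H ι ((fun p => p.1.1) '' D.verts) := by
  let ψ := coverEmbedding hι hH
  have common_translate := hD.exists_mem_mem
    (fun h : H => ((coverAut ι h).toEmbedding.comp ψ).range.comap (D.subtype Γ))
    (fun p => by
      obtain ⟨h, a, hp⟩ := exists_eq_smul_baseVertex p.1
      exact ⟨h, a, hp.symm⟩)
    (fun n r t ht => by
      obtain ⟨h, s, y, -, -, hty⟩ := ht
      exact ⟨h, fun i => ⟨y i, (hty i).symm⟩⟩)
  apply hconf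
  rintro _ ⟨p, hp, rfl⟩ _ ⟨q, hq, rfl⟩
  obtain ⟨h, ⟨a, ha⟩, b, hb⟩ := common_translate ⟨p, hp⟩ ⟨q, hq⟩
  have ha : h • baseVertex H ι a = p := ha
  have hb : h • baseVertex H ι b = q := hb
  refine ⟨h.1⁻¹, H.inv_mem h.2, ?_⟩
  rintro _ (rfl | rfl)
  · exact ⟨a, ha ▸ (inv_smul_smul h.1 (ι a)).symm⟩
  · exact ⟨b, hb ▸ (inv_smul_smul h.1 (ι b)).symm⟩

theorem isIrreducibleStructureFaithful_coverEmbedding (hι : Function.Injective ι)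
    (hH : ∀ h ∈ H, ∃ σ, Induces A ι h σ) (hconf : IsConformal H ι) :
    IsIrreducibleStructureFaithful (coverEmbedding hι hH) := by
  intro D hD
  obtain ⟨h, hh, hhD⟩ := isTranslatable_of_irreducible hι hH hconf hD
  refine ⟨coverAut ι ⟨h, hh⟩, ?_⟩
  rintro _ ⟨p, hp, rfl⟩
  obtain ⟨k, a, rfl⟩ := exists_eq_smul_baseVertex p
  have closure_mem : ∀ c ∈ (A.closure a).verts, k • baseVertex H ι c ∈ D.verts := fun c hc =>
    Struc.closure_subset
      (S := D.comap ((coverAut ι k).toEmbedding.comp (coverEmbedding hι hH))) hp hc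
  obtain ⟨σ, hσ⟩ := hH (h * k) (H.mul_mem hh k.2)
  refine ⟨σ a, Eq.trans ?_ (mul_smul ⟨h, hh⟩ k (baseVertex H ι a))⟩
  refine (Induces.smul_baseVertex (h := ⟨h, hh⟩ * k) hσ fun c hc => ?_).symm
  exact (mul_smul h k.1 (ι c)).symm ▸ hhD _ ⟨_, closure_mem c hc, rfl⟩

theorem exists_faithful_coherent_witness (A : Struc.{u, v, w} L) [Finite A.V]
    (hA : (MulAction.orbit Γ A.str).Finite) :
    ∃ B : Struc.{u, v, w} L, Finite B.V ∧ ∃ ψ : Embedding Γ A B,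
      IsCoherentEPPAEmbedding ψ ∧ IsIrreducibleStructureFaithful ψ := by
  obtain ⟨V, _, H, ι, hι, hExt, hH, hconf⟩ := exists_conformal_inducing_cover A hA
  exact ⟨coverStruc A H ι, Subtype.finite, coverEmbedding hι hH,
    isCoherentEPPAEmbedding_coverEmbedding hι hH hExt,
    isIrreducibleStructureFaithful_coverEmbedding hι hH hconf⟩

end EPPA

/-! ### Free amalgamation classes -/

section Classes

variable {L : UnaryLanguage.{u, v}} {Γ : Subgroup L.Perm} {A B C : Struc.{u, v, w} L}

section Glue

variable {S T : Substruc B}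

theorem Embedding.mem_rel_iff_of_eqOn {β : Embedding Γ S.toStruc C} {f : B.V → C.V}
    (hf : ∀ x : S.verts, f x = β.toFun x) {n} (r : L.Rel n) {x : Fin n → B.V}
    (hx : ∀ i, x i ∈ S.verts) :
    x ∈ B.str.rel n r ↔ f ∘ x ∈ C.str.rel n (β.lang.1.1 n r) := by
  rw [show f ∘ x = _ from funext fun i => hf ⟨x i, hx i⟩]
  exact β.map_rel n r fun i => ⟨x i, hx i⟩

theorem Embedding.image_fn_of_eqOn {β : Embedding Γ S.toStruc C} {f : B.V → C.V}
    (hf : ∀ x : S.verts, f x = β.toFun x) (F : L.Fn) {x : B.V} (hx : x ∈ S.verts) :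
    f '' B.str.fn F x = C.str.fn (β.lang.1.2 F) (f x) := by
  rw [hf ⟨x, hx⟩]
  refine Eq.trans (Set.Subset.antisymm ?_ ?_) (β.map_fn F ⟨x, hx⟩)
  · rintro _ ⟨z, hz, rfl⟩
    exact ⟨⟨z, S.closed F x hx hz⟩, hz, (hf ⟨z, S.closed F x hx hz⟩).symm⟩
  · rintro _ ⟨z, hz, rfl⟩
    exact ⟨z.1, hz, hf z⟩

variable {β₁ : Embedding Γ S.toStruc C} {β₂ : Embedding Γ T.toStruc C}

theorem IsAmalgamation.lang_eq
    (h : IsAmalgamation (S.interLeft Γ T) (S.interRight Γ T) β₁ β₂) : β₂.lang = β₁.lang := by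
  have : β₁.lang * 1 = β₂.lang * 1 := congrArg Embedding.lang h
  rw [mul_one, mul_one] at this
  exact this.symm

theorem IsStrongAmalgamation.apply_eq_apply_iff
    (h : IsStrongAmalgamation (S.interLeft Γ T) (S.interRight Γ T) β₁ β₂) (x : S.verts)
    (y : T.verts) : β₁.toFun x = β₂.toFun y ↔ x.1 = y.1 := by
  refine (h.2 x y).trans ⟨?_, fun hxy => ?_⟩
  · rintro ⟨a, rfl, rfl⟩
    rfl
  · exact ⟨⟨x.1, x.2, hxy ▸ y.2⟩, rfl, Subtype.ext hxy⟩

theorem IsStrongAmalgamation.exists_glue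
    (h : IsStrongAmalgamation (S.interLeft Γ T) (S.interRight Γ T) β₁ β₂)
    (cover : ∀ x, x ∈ S.verts ∨ x ∈ T.verts) :
    ∃ f : B.V → C.V, Function.Injective f ∧ (∀ x : S.verts, f x = β₁.toFun x) ∧
      ∀ x : T.verts, f x = β₂.toFun x := by
  classical
  let f (x : B.V) : C.V :=
    if hx : x ∈ S.verts then β₁.toFun ⟨x, hx⟩
    else β₂.toFun ⟨x, (cover x).resolve_left hx⟩
  have f_left (x : S.verts) : f x = β₁.toFun x := dif_pos x.2
  have f_right (x : T.verts) : f x = β₂.toFun x := by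
    by_cases hx : x.1 ∈ S.verts
    · exact (f_left ⟨x, hx⟩).trans ((h.apply_eq_apply_iff _ _).2 rfl)
    · exact dif_neg hx
  refine ⟨f, fun x y hxy => ?_, f_left, f_right⟩
  rcases cover x with hx | hx <;> rcases cover y with hy | hy
  · rw [f_left ⟨x, hx⟩, f_left ⟨y, hy⟩] at hxy
    exact congrArg Subtype.val (β₁.injective hxy)
  · rw [f_left ⟨x, hx⟩, f_right ⟨y, hy⟩] at hxy
    exact (h.apply_eq_apply_iff _ _).1 hxy
  · rw [f_right ⟨x, hx⟩, f_left ⟨y, hy⟩] at hxy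
    exact ((h.apply_eq_apply_iff _ _).1 hxy.symm).symm
  · rw [f_right ⟨x, hx⟩, f_right ⟨y, hy⟩] at hxy
    exact congrArg Subtype.val (β₂.injective hxy)

theorem Substruc.IsFreeCover.nonempty_embedding (hST : S.IsFreeCover T)
    (hC : IsFreeAmalgamation (S.interLeft Γ T) (S.interRight Γ T) β₁ β₂) :
    Nonempty (Embedding Γ B C) := by
  obtain ⟨strong, -, no_rel⟩ := hC
  obtain ⟨f, f_injective, f_left, f_right⟩ := strong.exists_glue hST.mem_or_mem
  have lang_eq := strong.1.lang_eq
  refine ⟨⟨β₁.lang, f, f_injective, fun n r x => ?_, fun F x => ?_⟩⟩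
  · by_cases hS : ∀ i, x i ∈ S.verts
    · exact Embedding.mem_rel_iff_of_eqOn f_left r hS
    by_cases hT : ∀ i, x i ∈ T.verts
    · exact lang_eq ▸ Embedding.mem_rel_iff_of_eqOn f_right r hT
    refine iff_of_false (fun hx => (hST.rel n r x hx).elim hS hT) ?_
    push Not at hS hT
    obtain ⟨i, hi⟩ := hS
    obtain ⟨j, hj⟩ := hT
    exact no_rel n _ (f ∘ x)
      ⟨j, ⟨x j, (hST.mem_or_mem _).resolve_right hj⟩, Substruc.mem_range_interLeft.not.2 hj,
        (f_left _).symm⟩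
      ⟨i, ⟨x i, (hST.mem_or_mem _).resolve_left hi⟩, Substruc.mem_range_interRight.not.2 hi,
        (f_right _).symm⟩
  · rcases hST.mem_or_mem x with hx | hx
    · exact Embedding.image_fn_of_eqOn f_left F hx
    · exact lang_eq ▸ Embedding.image_fn_of_eqOn f_right F hx

end Glue

theorem exists_isFreeCover_of_not_irreducible (hB : ¬ Irreducible Γ B) :
    ∃ S T : Substruc B, S.verts ≠ Set.univ ∧ T.verts ≠ Set.univ ∧ S.IsFreeCover T := by
  obtain ⟨S, T, hS, hT, hST⟩ := not_not.1 hB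
  exact ⟨S, T, hS, hT, Substruc.isFreeAmalgamation_subtype_iff.1 hST⟩

variable {K : Set (Struc.{u, v, w} L)}

theorem IsFreeAmalgamationClass.mem_of_isFreeCover (hK : IsFreeAmalgamationClass Γ K)
    {S T : Substruc B} (hS : S.toStruc ∈ K) (hT : T.toStruc ∈ K) (hST : S.IsFreeCover T) :
    B ∈ K := by
  obtain ⟨C, hC, β₁, β₂, hβ⟩ := hK.free_amalgamation (S.inter T).toStruc
    (hK.hereditary _ hS _ ⟨S.interLeft Γ T⟩) _ hS _ hT (S.interLeft Γ T) (S.interRight Γ T)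
  exact hK.hereditary C hC B (hST.nonempty_embedding hβ)

theorem IsFreeAmalgamationClass.mem_of_irreducible (hK : IsFreeAmalgamationClass Γ K)
    [Finite B.V] (hB : ∀ S : Substruc B, Irreducible Γ S.toStruc → S.toStruc ∈ K) : B ∈ K := by
  have substruc_mem (n : ℕ) : ∀ S : Substruc B, S.verts.ncard = n → S.toStruc ∈ K := by
    induction n using Nat.strong_induction_on with
    | _ n ih =>
      rintro S rfl
      by_cases irreducible : Irreducible Γ S.toStruc
      · exact hB S irreducible
      have proper_mem (T : Substruc S.toStruc) (hT : T.verts ≠ Set.univ) : T.toStruc ∈ K := by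
        refine hK.hereditary _ (ih (T.map (S.subtype Γ)).verts.ncard ?_ _ rfl) _
          (T.nonempty_embedding_map (S.subtype Γ))
        refine Set.ncard_lt_ncard ⟨?_, fun hS => hT (Set.eq_univ_iff_forall.2 fun x => ?_)⟩
        · rintro _ ⟨x, rfl⟩
          exact x.1.2
        · obtain ⟨y, hy⟩ := hS x.2
          exact (Subtype.ext hy : y.1 = x) ▸ y.2
      obtain ⟨T, U, hT, hU, hTU⟩ := exists_isFreeCover_of_not_irreducible irreducible
      exact hK.mem_of_isFreeCover (proper_mem T hT) (proper_mem U hU) hTU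
  let whole : Substruc B := ⟨Set.univ, fun _ _ _ => Set.subset_univ _⟩
  exact hK.hereditary _ (substruc_mem _ whole rfl) B
    (Embedding.nonempty_of_range_subset (f := .refl Γ B) (g := whole.subtype Γ)
      fun x _ => ⟨⟨x, trivial⟩, rfl⟩)

theorem IsFreeAmalgamationClass.hasFaithfulCoherentEPPA (hK : IsFreeAmalgamationClass Γ K)
    (hfin : ∀ A ∈ K, (MulAction.orbit Γ A.str).Finite) : HasFaithfulCoherentEPPA Γ K := by
  intro A hA
  have := hK.finite A hA
  obtain ⟨B, _, ψ, hψ, faithful⟩ := exists_faithful_coherent_witness A (hfin A hA)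
  refine ⟨B, hK.mem_of_irreducible fun S hS => ?_, ψ, hψ, faithful⟩
  obtain ⟨g, hg⟩ := faithful S hS
  refine hK.hereditary A hA _ (Embedding.nonempty_of_range_subset
    (f := g.toEmbedding.comp (S.subtype Γ)) (g := ψ) ?_)
  rintro _ ⟨x, rfl⟩
  exact hg ⟨x.1, x.2, rfl⟩

theorem HasFaithfulCoherentEPPA.hasEPPA (h : HasFaithfulCoherentEPPA Γ K) : HasEPPA Γ K := by
  intro A hA
  obtain ⟨B, hB, ψ, ⟨φ, hφ, -⟩, -⟩ := h A hA
  exact ⟨B, hB, ψ, fun p hp => ⟨φ ⟨p, hp⟩, hφ ⟨p, hp⟩⟩⟩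

/-- The interpretation on `V` for which `m` together with the relabelling `g` is structure
preserving. -/
def Interp.comap {V V' : Type w} (g : L.Perm) (m : V → V') (S : Interp L V') : Interp L V where
  rel n r := {x | m ∘ x ∈ S.rel n (g.1 n r)}
  fn F x := m ⁻¹' S.fn (g.2 F) (m x)

theorem Interp.smul_comap {V V' : Type w} (k g : L.Perm) (m : V → V') (S : Interp L V') :
    g • S.comap (k * g) m = S.comap k m := by
  refine Interp.ext (funext₂ fun n r => ?_) (funext₂ fun F x => ?_)
  · change {x | m ∘ x ∈ S.rel n (k.1 n (g.1 n ((g.1 n).symm r)))} = {x | m ∘ x ∈ _}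
    rw [Equiv.apply_symm_apply]
  · change m ⁻¹' S.fn (k.2 (g.2 (g.2.symm F))) (m x) = m ⁻¹' _
    rw [Equiv.apply_symm_apply]

theorem Embedding.comap_str (f : Embedding Γ A B) : B.str.comap f.lang.1 f.toFun = A.str :=
  Interp.ext (funext₂ fun n r => Set.ext fun x => (f.map_rel n r x).symm) (funext₂ fun F x => by
    change f.toFun ⁻¹' B.str.fn (f.lang.1.2 F) (f.toFun x) = A.str.fn F x
    rw [← f.map_fn, Set.preimage_image_eq _ f.injective])

/-- The partial automorphism with empty domain and language part `g`. -/
def PartialAut.ofLang (B : Struc.{u, v, w} L) (g : Γ) : PartialAut Γ B where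
  dom := ⟨∅, fun _ _ h => h.elim⟩
  cod := ⟨∅, fun _ _ h => h.elim⟩
  iso :=
    { lang := g
      toFun := id
      injective := Function.injective_id
      map_rel := fun n r x => by
        rcases n with _ | n
        · exact L.rel_zero.elim r
        · exact (x 0).2.elim
      map_fn := fun F x => x.2.elim
      surjective := Function.surjective_id }

theorem IsEPPAEmbedding.finite_orbit [Finite A.V] [Finite B.V] {ψ : Embedding Γ A B}
    (hψ : IsEPPAEmbedding ψ) : (MulAction.orbit Γ A.str).Finite := by
  refine (Set.finite_range fun m : A.V → B.V => B.str.comap ψ.lang.1 m).subset ?_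
  rintro _ ⟨g, rfl⟩
  obtain ⟨θ, hθ, -⟩ := hψ (.ofLang B (ψ.lang * g * ψ.lang⁻¹))
    ⟨Set.empty_subset _, Set.empty_subset _⟩
  have lang_comp : (θ.toEmbedding.comp ψ).lang = ψ.lang * g := by
    change θ.lang * ψ.lang = ψ.lang * g
    rw [hθ]
    exact inv_mul_cancel_right _ _
  refine ⟨(θ.toEmbedding.comp ψ).toFun, ?_⟩
  change _ = g.1 • A.str
  rw [← (θ.toEmbedding.comp ψ).comap_str, lang_comp]
  exact (Interp.smul_comap _ _ _ _).symm

end Classes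

end GammaL

theorem corollary1p4 (L : GammaL.UnaryLanguage.{u, v}) (Γ : Subgroup L.Perm)
    (K : Set (GammaL.Struc.{u, v, w} L)) (hK : GammaL.IsFreeAmalgamationClass Γ K) :
    (GammaL.HasEPPA Γ K ↔ ∀ A ∈ K, (MulAction.orbit Γ A.str).Finite) ∧
      (GammaL.HasEPPA Γ K → GammaL.HasFaithfulCoherentEPPA Γ K) := by
  have finite_orbit : GammaL.HasEPPA Γ K → ∀ A ∈ K, (MulAction.orbit Γ A.str).Finite := by
    intro hEPPA A hA
    obtain ⟨B, hB, ψ, hψ⟩ := hEPPA A hA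
    have := hK.finite A hA
    have := hK.finite B hB
    exact hψ.finite_orbit
  exact ⟨⟨finite_orbit, fun hfin => (hK.hasFaithfulCoherentEPPA hfin).hasEPPA⟩,
    fun hEPPA => hK.hasFaithfulCoherentEPPA (finite_orbit hEPPA)⟩
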